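/- Let $f(z)=\sum_{j\ge 0}a_jz^j$ be a transcendental entire function, let $\chi_0,\chi_1,\dots$ be independent, identically distributed complex-valued random variables on a probability space $(\Omega,\mathcal F,\mu)$ with mean $0$ and variance $1$, and put $$f_\omega(z)=\sum_{j\ge0}\chi_j(\omega)a_jz^j,\qquad f^*_\omega(z)=zf_\omega'(z)=\sum_{j\ge1}j\,a_j\chi_j(\omega)z^j .$$ For a random series $g_\omega(z)=\sum_j\chi_j(\omega)b_jz^j$ (with $\sum_j b_jz^j$ entire and not identically zero) put $\sigma(r)=\big(\sum_j|b_j|^2r^{2j}\big)^{1/2}$ and $$X_r(\omega)=\frac1{2\pi}\int_0^{2\pi}\Big|\log\frac{|g_\omega(re^{i\theta})|}{\sigma(r)}\Big|\,d\theta .$$ Say that $g_\omega$ satisfies Condition Y with constants $A,B>0$ if $\mathrm E\big(\exp(A|X_r|^B)\big)$ is finite for every $r>0$ and remains bounded as $r\to\infty$. Let $M(r,f)=\max_{|z|=r}|f(z)|$, and let $$N(r,a,f_\omega)=\int_0^r\frac{n(t)-n(0)}{t}\,dt+n(0)\log r,$$ where $n(t)$ is the number of zeros of $f_\omega-a$ in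 $|z|\le t$, counted with multiplicity. Suppose that $f_\omega$ satisfies Condition Y (with some constants), and that $f^*_\omega$ satisfies Condition Y with the constants $A,B$. Then for every $C>1$ there is a measurable set $E\subset(0,\infty)$ of finite logarithmic measure ($\int_E dr/r<\infty$), not depending on $\omega$ or $a$, such that for every $a\in\mathbb C$, almost surely, there is $r_1=r_1(\omega,a)$ such that for all $r>r_1$ with $r\notin E$, $$\big|\log M(r,f)-N(r,a,f_\omega)\big|\le \Big(\frac CA\Big)^{1/B}\big(\log\log M(r,f)\big)^{1/B}+(2+o(1))\log\log M(r,f),$$ where the $o(1)$ term tends to $0$ as $r\to\infty$ (for fixed $\omega$ and $a$). -/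

import Mathlib

open MeasureTheory ProbabilityTheory Filter Topology

open scoped ENNReal NNReal

namespace RandomEntire

noncomputable section

/-- A transcendental entire function: holomorphic on `ℂ` and not a polynomial. -/
def IsTranscendentalEntire (f : ℂ → ℂ) : Prop :=
  Differentiable ℂ f ∧ ¬ ∃ p : Polynomial ℂ, ∀ z, f z = p.eval z

/-- The maximum modulus `M(r, f) = max_{|z| = r} |f z|`. -/
def maxModulus (f : ℂ → ℂ) (r : ℝ) : ℝ :=
  sSup ((fun z => ‖f z‖) '' Metric.sphere (0 : ℂ) r)

/-- `σ(r) = (∑ |a_j|² r^{2j})^{1/2}` for the power series with coefficients `a`. -/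
def sigma (a : ℕ → ℂ) (r : ℝ) : ℝ :=
  Real.sqrt (∑' j, ‖a j‖ ^ 2 * r ^ (2 * j))

variable {Ω : Type*}

/-- The random function `f_ω(z) = ∑ χ_j(ω) a_j z^j`. -/
def randomSeries (χ : ℕ → Ω → ℂ) (a : ℕ → ℂ) (ω : Ω) (z : ℂ) : ℂ :=
  ∑' j, χ j ω * a j * z ^ j

/-- The coefficients `j a_j` of `z f'(z)`; thus `randomSeries χ (starCoeff a) ω` is
`z f_ω'(z) = ∑_{j ≥ 1} j a_j χ_j(ω) z^j`. -/
def starCoeff (a : ℕ → ℂ) (j : ℕ) : ℂ := (j : ℂ) * a j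

/-- `X_r(ω) = (1 / 2π) ∫_0^{2π} |log |f_ω(r e^{iθ}) / σ(r)|| dθ`. -/
def logDeviation (χ : ℕ → Ω → ℂ) (a : ℕ → ℂ) (r : ℝ) (ω : Ω) : ℝ :=
  Real.circleAverage (fun z => |Real.log (‖randomSeries χ a ω z‖ / sigma a r)|) 0 r

/-- Condition Y with the constants `A` and `B`: the exponential moment `E exp(A |X_r|^B)` is finite
for every `r > 0` and stays bounded as `r → ∞`. -/
def ConditionY [MeasurableSpace Ω] (μ : Measure Ω) (χ : ℕ → Ω → ℂ) (a : ℕ → ℂ) (A B : ℝ) : Prop :=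
  0 < A ∧ 0 < B ∧
  (∀ r : ℝ, 0 < r →
    ∫⁻ ω, ENNReal.ofReal (Real.exp (A * |logDeviation χ a r ω| ^ B)) ∂μ < ∞) ∧
  ∃ K : ℝ≥0, ∀ᶠ r : ℝ in atTop,
    ∫⁻ ω, ENNReal.ofReal (Real.exp (A * |logDeviation χ a r ω| ^ B)) ∂μ ≤ K

/-- A measurable set of positive reals of finite logarithmic measure: `∫_E dr / r < ∞`. -/
def HasFiniteLogMeasure (E : Set ℝ) : Prop :=
  MeasurableSet E ∧ E ⊆ Set.Ioi 0 ∧ ∫⁻ r in E, ENNReal.ofReal (1 / r) < ∞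

/-- The weighted counting function `N(r, a, g)` of the `a`-points of an entire function `g`, counted
with multiplicity:
`N(r, a, g) = ∫_0^r (n(t, 0, g - a) - n(0, 0, g - a)) / t dt + n(0, 0, g - a) log r`. -/
abbrev countingN (r : ℝ) (a : ℂ) (g : ℂ → ℂ) : ℝ :=
  ValueDistribution.logCounting g (a : WithTop ℂ) r

end

end RandomEntire

namespace RandomEntire

/-! By Jensen's formula, `N(r, a, f_ω)` is the mean of `log |f_ω - a|` over `|z| = r` up to a
constant, so this mean has to be compared with `log M(r, f)`.

Upper bound. Almost surely `∑ |χ_j|² / (j + 1)²` converges. Cauchy–Schwarz and Cauchy's estimates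
then give `|f_ω - a| ≤ K M(r (1 + δ)) δ ^ (-3/2)` on `|z| = r`. Borel's growth lemma with `δ = (1 +
log M) ^ (-5/4)` replaces `M(r (1 + δ))` by `e M(r)` off an exceptional set, at the cost of `(15/8)
log log M + O(1)` (`eventually_countingN_le`).

Lower bound. Differentiation removes `a`, so it suffices to bound the mean of `log |f*_ω|` from
below and to compare it with the mean of `log |f_ω - a|`. For the bound, Markov's inequality and
Borel–Cantelli turn Condition Y for `f*` into a bound of order `(log n) ^ (1 / B)` for the deviation
at radii where `σ* = exp n`. Both `σ*` and the mean of `log |f*_ω|` increase with `r`, so these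
radii control all others, and `log M ≤ log σ* + O(1)` with `n ≤ 4 log M`
(`eventually_log_maxModulus_le`). For the comparison, a lemma on the logarithmic derivative,
together with Borel's lemma applied to `log M`, costs only `(3/2) log log M`
(`eventually_circleAverage_star_le`).

As `15/8` and `3/2` are less than `2`, all additive constants are absorbed. The exceptional set
comes from the two uses of Borel's lemma, which involve `M(r, f)` alone. -/

/-! ### Pointwise bounds for logarithmic derivatives. -/

/-- A function without zeros on a disc of radius `ρ` and bounded there by `exp A` times its value at
the centre has logarithmic derivative at most `8 A ρ / (ρ - |z|) ^ 2`. -/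
lemma norm_logDeriv_le_of_ne_zero {B : ℂ → ℂ} {ρ A : ℝ} (hB : Differentiable ℂ B)
    (hne : ∀ z ∈ Metric.ball (0 : ℂ) ρ, B z ≠ 0) (hA : 0 < A)
    (hle : ∀ z ∈ Metric.ball (0 : ℂ) ρ, ‖B z‖ ≤ Real.exp A * ‖B 0‖) {z : ℂ} (hz : ‖z‖ < ρ) :
    ‖deriv B z / B z‖ ≤ 8 * A * ρ / (ρ - ‖z‖) ^ 2 := by
  have hρ : 0 < ρ := (norm_nonneg z).trans_lt hz
  have h0 : (0 : ℂ) ∈ Metric.ball (0 : ℂ) ρ := Metric.mem_ball_self hρ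
  have hdB : Differentiable ℂ (deriv B) := fun x =>
    ((hB.analyticAt x).deriv).differentiableAt
  have hd : DifferentiableOn ℂ (fun z => deriv B z / B z) (Metric.ball 0 ρ) := fun x hx =>
    ((hdB x).div (hB x) (hne x hx)).differentiableWithinAt
  -- `H` is the branch of `log (B / B 0)` vanishing at `0`. Its real part is at most `A`, so
  -- Borel–Carathéodory bounds `|H|`, and Cauchy's estimate on a circle about `z` bounds `H' = B' /
  -- B`.
  obtain ⟨H, hH0, hH⟩ := hd.isExactOn_ball.with_val_at 0 0
  have hHd : DifferentiableOn ℂ H (Metric.ball 0 ρ) := fun x hx =>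
    (hH x hx).differentiableAt.differentiableWithinAt
  have hconst : ∀ x ∈ Metric.ball (0 : ℂ) ρ, B x * Complex.exp (-H x) = B 0 := by
    intro x hx
    have hder : ∀ y ∈ Metric.ball (0 : ℂ) ρ,
        HasDerivAt (fun y => B y * Complex.exp (-H y)) 0 y := by
      intro y hy
      have := (hB y).hasDerivAt.mul ((hH y hy).neg.cexp)
      have hy0 := hne y hy
      have e : deriv B y * Complex.exp (-H y) +
          B y * (Complex.exp (-H y) * -(deriv B y / B y)) = 0 := by
        rw [mul_neg, mul_neg, mul_left_comm, mul_div_cancel₀ _ hy0]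
        ring
      rw [← e]
      exact this
    have := (convex_ball (0 : ℂ) ρ).is_const_of_fderivWithin_eq_zero (𝕜 := ℂ)
      (f := fun y => B y * Complex.exp (-H y))
      (fun y hy => (hder y hy).differentiableAt.differentiableWithinAt) (fun y hy => by
        rw [fderivWithin_of_isOpen Metric.isOpen_ball hy]
        have := (hder y hy).hasFDerivAt.fderiv
        rw [this]; ext; simp) hx h0
    simpa [hH0] using this
  have hre : Set.MapsTo H (Metric.ball 0 ρ) {w | w.re ≤ A} := by
    intro x hx
    have h1 : B x = B 0 * Complex.exp (H x) := by
      rw [← hconst x hx, mul_assoc, ← Complex.exp_add]; simp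
    have h2 := hle x hx
    rw [h1, norm_mul, Complex.norm_exp, mul_comm] at h2
    have h3 : 0 < ‖B 0‖ := norm_pos_iff.2 (hne 0 h0)
    exact Real.exp_le_exp.1 (le_of_mul_le_mul_right h2 h3)
  set d := (ρ - ‖z‖) / 2 with hddef
  have hdpos : 0 < d := by rw [hddef]; linarith
  have hsub : Metric.closedBall z d ⊆ Metric.ball 0 ρ := by
    intro w hw
    rw [mem_closedBall_iff_norm] at hw
    rw [mem_ball_zero_iff]
    have : ‖w‖ ≤ ‖w - z‖ + ‖z‖ := by simpa using norm_add_le (w - z) z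
    linarith
  have hcl : DiffContOnCl ℂ H (Metric.ball z d) :=
    (hHd.mono (by rw [closure_ball z hdpos.ne']; exact hsub)).diffContOnCl
  have hbd : ∀ w ∈ Metric.sphere z d, ‖H w‖ ≤ 2 * A * ρ / d := by
    intro w hw
    have hwb := hsub (Metric.sphere_subset_closedBall hw)
    have h1 := Complex.borelCaratheodory_zero hA hHd hre hρ hwb hH0
    rw [mem_sphere_iff_norm] at hw
    have h2 : ‖w‖ ≤ ρ - d := by
      have : ‖w‖ ≤ ‖w - z‖ + ‖z‖ := by simpa using norm_add_le (w - z) z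
      linarith
    refine h1.trans ?_
    gcongr <;> linarith
  have := Complex.norm_deriv_le_of_forall_mem_sphere_norm_le hdpos hcl hbd
  rw [(hH z (by simpa using hz)).deriv] at this
  refine this.trans_eq ?_
  rw [hddef]
  have : ρ - ‖z‖ ≠ 0 := by linarith
  field_simp
  ring

/-- The Blaschke-type modification `h(z) ∏ (R² - conj c_i z) / R` of `∏ (z - c_i) h(z)` is bounded on
the disc of radius `R` by the maximum of the latter function on the circle of radius `R`. -/
lemma norm_blaschke_le {n : ℕ} {c : Fin n → ℂ} {G h : ℂ → ℂ} (hh : Differentiable ℂ h)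
    (hG : ∀ z, G z = (∏ i, (z - c i)) * h z) {R M : ℝ} (hR : 0 < R)
    (hM : ∀ z, ‖z‖ = R → ‖G z‖ ≤ M) {z : ℂ} (hz : ‖z‖ ≤ R) :
    ‖(∏ i, ((R : ℂ) ^ 2 - (starRingEnd ℂ) (c i) * z) / R) * h z‖ ≤ M := by
  have hd : Differentiable ℂ
      (fun z => (∏ i, ((R : ℂ) ^ 2 - (starRingEnd ℂ) (c i) * z) / R) * h z) := by
    refine Differentiable.mul ?_ hh
    fun_prop
  refine Complex.norm_le_of_forall_mem_frontier_norm_le (U := Metric.ball 0 R)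
    Metric.isBounded_ball hd.diffContOnCl ?_ (z := z) ?_
  · intro w hw
    rw [frontier_ball _ hR.ne', mem_sphere_zero_iff_norm] at hw
    refine le_trans (le_of_eq ?_) (hM w hw)
    rw [hG, norm_mul, norm_mul, norm_prod, norm_prod]
    congr 1
    refine Finset.prod_congr rfl fun i _ => ?_
    -- On the circle `R² - conj c w = w conj (w - c)`, so replacing the factors does not change the
    -- modulus there.
    have h1 : (R : ℂ) ^ 2 = w * (starRingEnd ℂ) w := by
      rw [Complex.mul_conj, Complex.normSq_eq_norm_sq, hw]; push_cast; ring
    rw [h1, mul_comm _ w, ← mul_sub, ← map_sub, norm_div, norm_mul, Complex.norm_conj, hw,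
      Complex.norm_real, Real.norm_of_nonneg hR.le]
    field_simp
  · rw [closure_ball _ hR.ne']; simpa using hz

/-- At the origin each factor of modulus `|c i| ≤ ρ` is replaced by one of modulus `R`, a gain of at
least `R / ρ` per zero. With the maximum principle this bounds the number of zeros, as in Jensen's
inequality. -/
lemma norm_mul_pow_le_of_zeros {n : ℕ} {c : Fin n → ℂ} {G h : ℂ → ℂ} (hh : Differentiable ℂ h)
    (hG : ∀ z, G z = (∏ i, (z - c i)) * h z) {ρ R M : ℝ} (hρ : 0 < ρ) (hR : 0 < R)
    (hc : ∀ i, ‖c i‖ ≤ ρ) (hM : ∀ z, ‖z‖ = R → ‖G z‖ ≤ M) :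
    ‖G 0‖ * (R / ρ) ^ n ≤ ‖(∏ i, ((R : ℂ) ^ 2 - (starRingEnd ℂ) (c i) * 0) / R) * h 0‖ ∧
      ‖G 0‖ * (R / ρ) ^ n ≤ M := by
  have key : ‖G 0‖ * (R / ρ) ^ n ≤
      ‖(∏ i, ((R : ℂ) ^ 2 - (starRingEnd ℂ) (c i) * 0) / R) * h 0‖ := by
    rw [hG, norm_mul, norm_mul, norm_prod, norm_prod]
    have h1 : ∏ i, ‖(0 : ℂ) - c i‖ ≤ ρ ^ n := by
      have := Finset.prod_le_prod (s := Finset.univ) (f := fun i => ‖(0 : ℂ) - c i‖)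
        (g := fun _ => ρ) (fun i _ => norm_nonneg _) (fun i _ => by simpa using hc i)
      simpa using this
    have h2 : ∏ i : Fin n, ‖((R : ℂ) ^ 2 - (starRingEnd ℂ) (c i) * 0) / R‖ = R ^ n := by
      have : ∀ i : Fin n, ‖((R : ℂ) ^ 2 - (starRingEnd ℂ) (c i) * 0) / R‖ = R := by
        intro i
        rw [mul_zero, sub_zero, sq, mul_div_assoc, div_self (by exact_mod_cast hR.ne'), mul_one,
          Complex.norm_real, Real.norm_of_nonneg hR.le]
      rw [Finset.prod_congr rfl fun i _ => this i]
      simp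
    rw [h2]
    calc (∏ i, ‖(0 : ℂ) - c i‖) * ‖h 0‖ * (R / ρ) ^ n ≤ ρ ^ n * ‖h 0‖ * (R / ρ) ^ n := by gcongr
      _ = R ^ n * ‖h 0‖ := by rw [div_pow]; field_simp
  exact ⟨key, key.trans (norm_blaschke_le hh hG hR hM (by simpa using hR.le))⟩

/-- The zeros of an entire function in a closed disc can be split off as a polynomial factor. -/
lemma exists_factor_zeros {G : ℂ → ℂ} (hGd : Differentiable ℂ G) (hG0 : G 0 ≠ 0) {ρ : ℝ}
    (hρ : 0 < ρ) :
    ∃ (n : ℕ) (c : Fin n → ℂ) (h : ℂ → ℂ), Differentiable ℂ h ∧ (∀ i, ‖c i‖ ≤ ρ) ∧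
      (∀ z, G z = (∏ i, (z - c i)) * h z) ∧ ∀ z, ‖z‖ ≤ ρ → h z ≠ 0 := by
  let P : ℕ → Prop := fun n => ∃ (c : Fin n → ℂ) (h : ℂ → ℂ), Differentiable ℂ h ∧
    (∀ i, ‖c i‖ ≤ ρ) ∧ ∀ z, G z = (∏ i, (z - c i)) * h z
  have hP0 : P 0 := ⟨fun i => i.elim0, G, hGd, fun i => i.elim0, fun z => by simp⟩
  obtain ⟨M, hM⟩ : ∃ M, ∀ z ∈ Metric.sphere (0 : ℂ) (2 * ρ), ‖G z‖ ≤ M :=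
    (isCompact_sphere 0 (2 * ρ)).exists_bound_of_continuousOn hGd.continuous.continuousOn
  -- With outer radius `2 ρ` the zero count reads `2 ^ n ‖G 0‖ ≤ M`, so at most `N` factors can be
  -- split off. For the largest possible number, the cofactor has no zero left in the disc, since
  -- `dslope` would split it off too.
  obtain ⟨N, hN⟩ := pow_unbounded_of_one_lt (M / ‖G 0‖) (one_lt_two (α := ℝ))
  have hbound : ∀ n, P n → n ≤ N := by
    rintro n ⟨c, h, hh, hc, hG⟩
    have := (norm_mul_pow_le_of_zeros hh hG hρ (by linarith : (0 : ℝ) < 2 * ρ) hc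
      (fun z hz => hM z (by simpa using hz))).2
    rw [mul_div_assoc, div_self hρ.ne', mul_one] at this
    by_contra hlt
    push Not at hlt
    have h2 : (2 : ℝ) ^ n ≤ M / ‖G 0‖ := by
      rw [le_div_iff₀ (norm_pos_iff.2 hG0)]; linarith
    have h3 : (2 : ℝ) ^ N ≤ 2 ^ n := pow_le_pow_right₀ one_le_two hlt.le
    linarith
  classical
  obtain ⟨c, h, hh, hc, hG⟩ := Nat.findGreatest_spec (P := P) (Nat.zero_le N) hP0
  refine ⟨_, c, h, hh, hc, hG, ?_⟩
  intro w hw hhw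
  have hstep : P (Nat.findGreatest P N + 1) := by
    refine ⟨Fin.cons w c, dslope h w, ?_, ?_, ?_⟩
    · have := (Complex.differentiableOn_dslope (f := h) (s := Set.univ) (c := w)
        Filter.univ_mem).2 hh.differentiableOn
      exact differentiableOn_univ.1 this
    · intro i
      refine Fin.cases ?_ ?_ i
      · simpa using hw
      · intro j; simpa using hc j
    · intro z
      have h1 : (z - w) * dslope h w z = h z := by
        have := sub_smul_dslope h w z
        simpa [hhw] using this
      rw [hG z, Fin.prod_univ_succ]
      simp only [Fin.cons_zero, Fin.cons_succ]
      rw [← h1]; ring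
  have := Nat.le_findGreatest (P := P) (hbound _ hstep) hstep
  omega

/-- A pointwise estimate of the logarithmic derivative of an entire function by its zeros and its
growth. -/
lemma exists_norm_logDeriv_le {G : ℂ → ℂ} (hGd : Differentiable ℂ G) (hG0 : G 0 ≠ 0) {r δ A : ℝ}
    (hr : 0 < r) (hδ : 0 < δ) (hδ1 : δ ≤ 1) (hA : 1 ≤ A)
    (hle : ∀ z, ‖z‖ = r * (1 + 2 * δ) → ‖G z‖ ≤ Real.exp A * ‖G 0‖) :
    ∃ (n : ℕ) (c : Fin n → ℂ), (n : ℝ) ≤ 3 * A / δ ∧ ∀ z, ‖z‖ = r → G z ≠ 0 →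
      ‖z * deriv G z / G z‖ ≤ ∑ i, r / ‖z - c i‖ + 20 * A / δ ^ 2 := by
  -- Two gaps of width `r δ`: the one from `r` to `ρ` is for the derivative estimate of the
  -- zero-free function `B`, the one from `ρ` to `R` for counting the zeros.
  set ρ := r * (1 + δ) with hρdef
  set R := r * (1 + 2 * δ) with hRdef
  have hρ : 0 < ρ := by positivity
  have hR : 0 < R := by positivity
  have hρR : ρ < R := by rw [hρdef, hRdef]; gcongr; linarith
  obtain ⟨n, c, h, hh, hc, hG, hne⟩ := exists_factor_zeros hGd hG0 hρ
  have hG0' := norm_pos_iff.2 hG0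
  have hz := norm_mul_pow_le_of_zeros hh hG hρ hR hc hle
  have hn : (n : ℝ) ≤ 3 * A / δ := by
    have h1 : (R / ρ) ^ n ≤ Real.exp A := by
      have := hz.2
      rw [mul_comm] at this
      exact le_of_mul_le_mul_right this hG0'
    have h2 : 1 + δ / 2 ≤ R / ρ := by
      rw [le_div_iff₀ hρ, hρdef, hRdef]; nlinarith [mul_nonneg hr.le (by nlinarith : 0 ≤ δ - δ ^ 2)]
    -- Each zero gains a factor `exp (δ / 3)`, and the total gain is at most `exp A`; hence `n ≤ 3 A
    -- / δ`.
    have h3 : Real.exp (δ / 3) ≤ R / ρ := by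
      refine le_trans ?_ h2
      have := Real.abs_exp_sub_one_sub_id_le (x := δ / 3) (by rw [abs_of_pos] <;> linarith)
      have := (abs_le.1 this).2
      nlinarith
    have h4 : Real.exp (δ / 3 * n) ≤ Real.exp A := by
      rw [mul_comm, Real.exp_nat_mul]
      exact (pow_le_pow_left₀ (Real.exp_pos _).le h3 n).trans h1
    have h5 := Real.exp_le_exp.1 h4
    rw [le_div_iff₀ hδ]; linarith
  refine ⟨n, c, hn, ?_⟩
  intro z hzr hGz
  set B : ℂ → ℂ := fun z => (∏ i, ((R : ℂ) ^ 2 - (starRingEnd ℂ) (c i) * z) / R) * h z with hBdef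
  have hBd : Differentiable ℂ B := by
    refine Differentiable.mul ?_ hh
    fun_prop
  have hRc : (R : ℂ) ≠ 0 := by exact_mod_cast hR.ne'
  have hcz : ∀ i, ∀ w : ℂ, ‖w‖ ≤ ρ → R * (R - ‖w‖) ≤ ‖(R : ℂ) ^ 2 - (starRingEnd ℂ) (c i) * w‖ := by
    intro i w hw
    have h1 : ‖(R : ℂ) ^ 2‖ - ‖(starRingEnd ℂ) (c i) * w‖ ≤
      ‖(R : ℂ) ^ 2 - (starRingEnd ℂ) (c i) * w‖ := norm_sub_norm_le _ _
    rw [norm_pow, Complex.norm_real, Real.norm_of_nonneg hR.le, norm_mul, Complex.norm_conj] at h1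
    have h2 : ‖c i‖ * ‖w‖ ≤ R * ‖w‖ := by
      have := (hc i).trans hρR.le
      gcongr
    nlinarith
  have hfac : ∀ i, ∀ w : ℂ, ‖w‖ ≤ ρ → (R : ℂ) ^ 2 - (starRingEnd ℂ) (c i) * w ≠ 0 := by
    intro i w hw
    rw [← norm_pos_iff]
    refine lt_of_lt_of_le ?_ (hcz i w hw)
    have : 0 < R - ‖w‖ := by linarith
    positivity
  have hBne : ∀ w : ℂ, ‖w‖ ≤ ρ → B w ≠ 0 := by
    intro w hw
    refine mul_ne_zero (Finset.prod_ne_zero_iff.2 fun i _ => div_ne_zero (hfac i w hw) hRc)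
      (hne w hw)
  have hB0 : ‖G 0‖ ≤ ‖B 0‖ := by
    refine le_trans ?_ hz.1
    refine le_mul_of_one_le_right hG0'.le (one_le_pow₀ ?_)
    rw [le_div_iff₀ hρ]; linarith
  have hzρ : ‖z‖ < ρ := by rw [hzr, hρdef]; nlinarith
  have hBbd := norm_logDeriv_le_of_ne_zero hBd (ρ := ρ) (A := A)
    (fun w hw => hBne w (mem_ball_zero_iff.1 hw).le) (by linarith)
    (fun w hw => by
      refine (norm_blaschke_le hh hG hR hle ((mem_ball_zero_iff.1 hw).le.trans hρR.le)).trans ?_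
      gcongr) hzρ
  have hhz := hne z hzρ.le
  have hzc : ∀ i, z - c i ≠ 0 := by
    intro i hi
    apply hGz
    rw [hG z, Finset.prod_eq_zero (Finset.mem_univ i) hi, zero_mul]
  have hGl : deriv G z / G z = ∑ i, 1 / (z - c i) + deriv h z / h z := by
    have e : G = fun z => (∏ i, (z - c i)) * h z := funext hG
    rw [← logDeriv_apply, e, logDeriv_mul (f := fun z => ∏ i, (z - c i)) z
      (Finset.prod_ne_zero_iff.2 fun i _ => hzc i) hhz (by fun_prop) (hh z),
      logDeriv_prod (f := fun i z => z - c i) (fun i _ => hzc i) (fun i _ => by fun_prop)]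
    congr 1
    refine Finset.sum_congr rfl fun i _ => ?_
    rw [logDeriv_apply]
    simp
  have hBl : deriv B z / B z = ∑ i, -(starRingEnd ℂ) (c i) /
      ((R : ℂ) ^ 2 - (starRingEnd ℂ) (c i) * z) + deriv h z / h z := by
    rw [← logDeriv_apply, hBdef,
      logDeriv_mul (f := fun z => ∏ i, ((R : ℂ) ^ 2 - (starRingEnd ℂ) (c i) * z) / R) z
      (Finset.prod_ne_zero_iff.2 fun i _ => div_ne_zero (hfac i z hzρ.le) hRc) hhz
      (by fun_prop) (hh z),
      logDeriv_prod (f := fun i z => ((R : ℂ) ^ 2 - (starRingEnd ℂ) (c i) * z) / R)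
      (fun i _ => div_ne_zero (hfac i z hzρ.le) hRc) (fun i _ => by fun_prop)]
    congr 1
    refine Finset.sum_congr rfl fun i _ => ?_
    have h1 : HasDerivAt (fun z => ((R : ℂ) ^ 2 - (starRingEnd ℂ) (c i) * z) / R)
        ((-((starRingEnd ℂ) (c i) * 1)) / R) z :=
      (((hasDerivAt_id z).const_mul _).const_sub _).div_const _
    rw [logDeriv_apply, h1.deriv]
    have := hfac i z hzρ.le
    field_simp
  -- `G` and `B` share the cofactor `h`, so their logarithmic derivatives differ only by the
  -- explicit sums over the zeros. The last two terms contribute `16 A / δ²` and `4 A / δ²`.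
  have hdecomp : z * deriv G z / G z = ∑ i, z / (z - c i) + z * (deriv B z / B z) +
      ∑ i, z * (starRingEnd ℂ) (c i) / ((R : ℂ) ^ 2 - (starRingEnd ℂ) (c i) * z) := by
    rw [mul_div_assoc, hGl, hBl]
    have e1 : ∑ i, z / (z - c i) = z * ∑ i, 1 / (z - c i) := by
      rw [Finset.mul_sum]; exact Finset.sum_congr rfl fun i _ => by ring
    have e2 : ∑ i, z * (starRingEnd ℂ) (c i) / ((R : ℂ) ^ 2 - (starRingEnd ℂ) (c i) * z) =
        - (z * ∑ i, -(starRingEnd ℂ) (c i) / ((R : ℂ) ^ 2 - (starRingEnd ℂ) (c i) * z)) := by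
      rw [Finset.mul_sum, ← Finset.sum_neg_distrib]
      exact Finset.sum_congr rfl fun i _ => by ring
    rw [e1, e2]; ring
  have b1 : ‖∑ i, z / (z - c i)‖ ≤ ∑ i, r / ‖z - c i‖ := by
    refine (norm_sum_le _ _).trans_eq (Finset.sum_congr rfl fun i _ => ?_)
    rw [norm_div, hzr]
  have b2 : ‖z * (deriv B z / B z)‖ ≤ 16 * A / δ ^ 2 := by
    rw [norm_mul, hzr]
    have : r * (8 * A * ρ / (ρ - ‖z‖) ^ 2) ≤ 16 * A / δ ^ 2 := by
      have e : ρ - ‖z‖ = r * δ := by rw [hzr, hρdef]; ring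
      rw [e, hρdef]
      have e2 : r * (8 * A * (r * (1 + δ)) / (r * δ) ^ 2) = 8 * A * (1 + δ) / δ ^ 2 := by
        field_simp
      rw [e2]
      refine div_le_div_of_nonneg_right ?_ (by positivity)
      nlinarith
    exact le_trans (by gcongr) this
  have b3 : ‖∑ i, z * (starRingEnd ℂ) (c i) / ((R : ℂ) ^ 2 - (starRingEnd ℂ) (c i) * z)‖ ≤
      4 * A / δ ^ 2 := by
    have h1 : ∀ i, ‖z * (starRingEnd ℂ) (c i) / ((R : ℂ) ^ 2 - (starRingEnd ℂ) (c i) * z)‖ ≤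
        1 / (2 * δ) := by
      intro i
      have h2 := hcz i z hzρ.le
      have e : R - ‖z‖ = r * (2 * δ) := by rw [hzr, hRdef]; ring
      rw [e] at h2
      rw [norm_div, norm_mul, Complex.norm_conj, hzr]
      rw [div_le_div_iff₀ (norm_pos_iff.2 (hfac i z hzρ.le)) (by positivity)]
      have h3 : ‖c i‖ ≤ R := (hc i).trans hρR.le
      have h4 : r * ‖c i‖ * (2 * δ) ≤ r * R * (2 * δ) := by gcongr
      nlinarith
    calc _ ≤ ∑ i : Fin n, 1 / (2 * δ) := norm_sum_le_of_le _ fun i _ => h1 i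
      _ = n * (1 / (2 * δ)) := by simp
      _ ≤ 3 * A / δ * (1 / (2 * δ)) := by gcongr
      _ = (3 / 2) * A / δ ^ 2 := by field_simp
      _ ≤ 4 * A / δ ^ 2 := by gcongr; norm_num
  rw [hdecomp]
  calc _ ≤ _ := norm_add₃_le
    _ ≤ ∑ i, r / ‖z - c i‖ + 16 * A / δ ^ 2 + 4 * A / δ ^ 2 := by gcongr
    _ = _ := by ring

/-! ### Circle averages and the lemma on the logarithmic derivative. -/

lemma countable_setOf_sin_sub_eq_zero (φ : ℝ) : {θ : ℝ | Real.sin (θ - φ) = 0}.Countable := by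
  refine (Set.countable_range (fun n : ℤ => (n : ℝ) * Real.pi + φ)).mono ?_
  intro θ hθ
  obtain ⟨n, hn⟩ := Real.sin_eq_zero_iff.1 hθ
  exact ⟨n, by simp only; linarith⟩

/-- Jordan's inequality `sin θ ≥ 2 θ / π` reduces the first quarter period to `θ ^ (-3/4)`;
reflection and translation give the rest. An exponent below `1` ensures integrability, and its
inverse `4/3` leaves room below `2` in the final estimate. -/
lemma intervalIntegrable_abs_sin_rpow :
    IntervalIntegrable (fun θ => |Real.sin θ| ^ (-(3 / 4) : ℝ)) volume 0 (2 * Real.pi) := by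
  have hmeas : Measurable (fun θ => |Real.sin θ| ^ (-(3 / 4) : ℝ)) := by fun_prop
  have hpi := Real.pi_pos
  have h1 : IntervalIntegrable (fun θ => |Real.sin θ| ^ (-(3 / 4) : ℝ)) volume 0
      (Real.pi / 2) := by
    have h0 : IntervalIntegrable (fun θ : ℝ => (2 / Real.pi) ^ (-(3 / 4) : ℝ) *
        θ ^ (-(3 / 4) : ℝ)) volume 0 (Real.pi / 2) :=
      (intervalIntegral.intervalIntegrable_rpow' (by norm_num)).const_mul _
    refine h0.mono_fun hmeas.aestronglyMeasurable ?_
    refine (ae_restrict_iff' measurableSet_uIoc).2 (ae_of_all _ fun θ hθ => ?_)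
    rw [Set.uIoc_of_le (by positivity)] at hθ
    have hs := Real.mul_le_sin hθ.1.le hθ.2
    have hpos : 0 < 2 / Real.pi * θ := mul_pos (by positivity) hθ.1
    have hs0 : 0 ≤ Real.sin θ := hpos.le.trans hs
    show ‖|Real.sin θ| ^ (-(3 / 4) : ℝ)‖ ≤ ‖(2 / Real.pi) ^ (-(3 / 4) : ℝ) * θ ^ (-(3 / 4) : ℝ)‖
    rw [← Real.mul_rpow (by positivity) hθ.1.le, abs_of_nonneg hs0,
      Real.norm_of_nonneg (Real.rpow_nonneg hs0 _), Real.norm_of_nonneg (Real.rpow_nonneg hpos.le _)]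
    exact Real.rpow_le_rpow_of_nonpos hpos hs (by norm_num)
  have h2 : IntervalIntegrable (fun θ => |Real.sin θ| ^ (-(3 / 4) : ℝ)) volume
      (Real.pi / 2) Real.pi := by
    have := h1.comp_sub_left Real.pi
    simp only [Real.sin_pi_sub, sub_zero] at this
    have e : Real.pi - Real.pi / 2 = Real.pi / 2 := by ring
    rw [e] at this
    exact this.symm
  have h3 := h1.trans h2
  have h4 : IntervalIntegrable (fun θ => |Real.sin θ| ^ (-(3 / 4) : ℝ)) volume
      Real.pi (2 * Real.pi) := by
    have := h3.comp_sub_right Real.pi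
    simp only [Real.sin_sub_pi, abs_neg, zero_add] at this
    rwa [← two_mul] at this
  exact h3.trans h4

/-- The circle averages of `(r / |z - c|) ^ (3 / 4)` are bounded uniformly in `c` and `r`. -/
lemma exists_circleAverage_rpow_le : ∃ K : ℝ, 0 < K ∧ ∀ (c : ℂ) (r : ℝ), 0 < r →
    CircleIntegrable (fun z => (r / ‖z - c‖) ^ (3 / 4 : ℝ)) 0 r ∧
      Real.circleAverage (fun z => (r / ‖z - c‖) ^ (3 / 4 : ℝ)) 0 r ≤ K := by
  set I := ∫ θ in (0 : ℝ)..2 * Real.pi, |Real.sin θ| ^ (-(3 / 4) : ℝ) with hI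
  have hpi := Real.pi_pos
  have hI0 : 0 ≤ I := intervalIntegral.integral_nonneg (by positivity)
    fun θ _ => Real.rpow_nonneg (abs_nonneg _) _
  refine ⟨(2 * Real.pi)⁻¹ * I + 1, by positivity, ?_⟩
  intro c r hr
  set φ := Complex.arg c with hφ
  have hper : Function.Periodic (fun θ => |Real.sin θ| ^ (-(3 / 4) : ℝ)) (2 * Real.pi) := by
    intro θ; simp [Real.sin_add_two_pi]
  have hint : IntervalIntegrable (fun θ => |Real.sin (θ - φ)| ^ (-(3 / 4) : ℝ)) volume 0
      (2 * Real.pi) := by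
    have h1 : IntervalIntegrable (fun θ => |Real.sin θ| ^ (-(3 / 4) : ℝ)) volume (-φ)
        (2 * Real.pi - φ) :=
      hper.intervalIntegrable (t := 0) (by positivity)
        (by simpa using intervalIntegrable_abs_sin_rpow) _ _
    have := h1.comp_sub_right φ
    simpa using this
  have hval : ∫ θ in (0 : ℝ)..2 * Real.pi, |Real.sin (θ - φ)| ^ (-(3 / 4) : ℝ) = I := by
    rw [intervalIntegral.integral_comp_sub_right (fun θ => |Real.sin θ| ^ (-(3 / 4) : ℝ)) φ]
    have := hper.intervalIntegral_add_eq (0 - φ) 0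
    rw [zero_add, zero_sub, neg_add_eq_sub] at this
    rw [hI, ← this, zero_sub]
  -- After rotating `c` onto the positive axis, the distance is at least the imaginary part, which
  -- does not involve `|c|`.
  have hdist : ∀ θ, r * |Real.sin (θ - φ)| ≤ ‖circleMap 0 r θ - c‖ := by
    intro θ
    have h1 : circleMap 0 r θ - c = Complex.exp (φ * Complex.I) *
        (r * Complex.exp ((θ - φ : ℝ) * Complex.I) - ‖c‖) := by
      rw [mul_sub, mul_left_comm, ← Complex.exp_add, mul_comm _ (‖c‖ : ℂ),
        Complex.norm_mul_exp_arg_mul_I]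
      simp only [circleMap, zero_add]
      congr 3
      push_cast; ring
    have h2 : (r * Complex.exp ((θ - φ : ℝ) * Complex.I) - ‖c‖).im = r * Real.sin (θ - φ) := by
      rw [Complex.sub_im, Complex.im_ofReal_mul,
        Complex.exp_ofReal_mul_I_im, Complex.ofReal_im, sub_zero]
    rw [h1, norm_mul, Complex.norm_exp_ofReal_mul_I, one_mul]
    refine le_trans (le_of_eq ?_) (Complex.abs_im_le_norm _)
    rw [h2, abs_mul, abs_of_pos hr]
  have hae : ∀ᵐ θ : ℝ, (r / ‖circleMap 0 r θ - c‖) ^ (3 / 4 : ℝ) ≤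
      |Real.sin (θ - φ)| ^ (-(3 / 4) : ℝ) := by
    filter_upwards [(countable_setOf_sin_sub_eq_zero φ).ae_notMem volume] with θ hθ
    have hs : 0 < |Real.sin (θ - φ)| := abs_pos.2 hθ
    rw [Real.rpow_neg hs.le, ← Real.inv_rpow hs.le]
    refine Real.rpow_le_rpow (by positivity) ?_ (by norm_num)
    have h := hdist θ
    have h0 : 0 < ‖circleMap 0 r θ - c‖ := lt_of_lt_of_le (by positivity) h
    rw [div_le_iff₀ h0, ← div_eq_inv_mul, le_div_iff₀ hs]
    exact h
  have hmeas : Measurable (fun θ => (r / ‖circleMap 0 r θ - c‖) ^ (3 / 4 : ℝ)) := by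
    have := (continuous_circleMap 0 r).measurable
    fun_prop
  have hci : IntervalIntegrable (fun θ => (r / ‖circleMap 0 r θ - c‖) ^ (3 / 4 : ℝ)) volume 0
      (2 * Real.pi) := by
    refine hint.mono_fun hmeas.aestronglyMeasurable (ae_restrict_of_ae ?_)
    filter_upwards [hae] with θ hθ
    rw [Real.norm_of_nonneg (by positivity), Real.norm_of_nonneg (by positivity)]
    exact hθ
  refine ⟨hci, ?_⟩
  rw [Real.circleAverage_def, smul_eq_mul]
  have := intervalIntegral.integral_mono_ae (by positivity) hci hint hae
  rw [hval] at this
  have : (2 * Real.pi)⁻¹ * ∫ θ in (0 : ℝ)..2 * Real.pi, (r / ‖circleMap 0 r θ - c‖) ^ (3 / 4 : ℝ) ≤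
    (2 * Real.pi)⁻¹ * I := by gcongr
  linarith

/-- The exceptional points are zeros, where the convention `Real.log 0 = 0` spoils pointwise
inequalities. A countable set has null preimage under `circleMap`. -/
lemma circleAverage_mono_of_countable {f g : ℂ → ℝ} {r : ℝ} (hr : r ≠ 0)
    (hf : CircleIntegrable f 0 r) (hg : CircleIntegrable g 0 r) {S : Set ℂ} (hS : S.Countable)
    (h : ∀ z, ‖z‖ = |r| → z ∉ S → f z ≤ g z) :
    Real.circleAverage f 0 r ≤ Real.circleAverage g 0 r := by
  rw [Real.circleAverage_def, Real.circleAverage_def, smul_eq_mul, smul_eq_mul]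
  refine mul_le_mul_of_nonneg_left ?_ (by positivity)
  refine intervalIntegral.integral_mono_ae (by positivity) hf hg ?_
  filter_upwards [(hS.preimage_circleMap 0 hr).ae_notMem volume] with θ hθ
  exact h _ (by simp) hθ

lemma countable_zeros {G : ℂ → ℂ} (hG : Differentiable ℂ G) {z₀ : ℂ} (h0 : G z₀ ≠ 0) :
    {z | G z = 0}.Countable := by
  have hA : AnalyticOnNhd ℂ G Set.univ := fun z _ => hG.analyticAt z
  have : ∀ z, ∀ᶠ w in 𝓝[≠] z, G w ≠ 0 := by
    intro z
    rcases (hG.analyticAt z).eventually_eq_zero_or_eventually_ne_zero with h | h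
    · exact absurd (hA.eqOn_zero_of_preconnected_of_eventuallyEq_zero isPreconnected_univ
        (Set.mem_univ z) h (Set.mem_univ z₀)) h0
    · exact h
  have hd : DiscreteTopology {z | G z = 0} := by
    rw [discreteTopology_subtype_iff]
    intro z _
    rw [Filter.inf_principal_eq_bot]
    filter_upwards [this z] with w hw using hw
  exact Set.countable_coe_iff.1 (TopologicalSpace.separableSpace_iff_countable.1 inferInstance)

lemma rpow_sum_le {n : ℕ} (f : Fin n → ℝ) (hf : ∀ i, 0 ≤ f i) :
    (∑ i, f i) ^ (3 / 4 : ℝ) ≤ ∑ i, f i ^ (3 / 4 : ℝ) := by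
  induction n with
  | zero => simp
  | succ n ih =>
    rw [Fin.sum_univ_succ, Fin.sum_univ_succ]
    have h1 := Real.rpow_add_le_add_rpow (hf 0)
      (Finset.sum_nonneg fun (i : Fin n) (_ : i ∈ Finset.univ) => hf i.succ) (p := 3 / 4)
      (by norm_num) (by norm_num)
    have h2 := ih (fun i => f (Fin.succ i)) (fun i => hf _)
    linarith

/-- A form of the lemma on the logarithmic derivative: for an entire function `G = z ^ k G₁`, the
circle averages of `log |z G'|` and `log |G|` differ by at most `(4 / 3) log (K (k + 1) A / δ ^ 2)`
if `|G₁| ≤ exp A |G₁ 0|` on the circle of radius `r (1 + 2 δ)`. -/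
theorem exists_circleAverage_log_deriv_le : ∃ K : ℝ, 1 ≤ K ∧
    ∀ (G G₁ : ℂ → ℂ) (k : ℕ), Differentiable ℂ G₁ → G₁ 0 ≠ 0 → (∀ z, G z = z ^ k * G₁ z) →
      (∃ z, deriv G z ≠ 0) → ∀ r δ A : ℝ, 0 < r → 0 < δ → δ ≤ 1 → 1 ≤ A →
      (∀ z, ‖z‖ = r * (1 + 2 * δ) → ‖G₁ z‖ ≤ Real.exp A * ‖G₁ 0‖) →
      Real.circleAverage (fun z => Real.log ‖z * deriv G z‖) 0 r -
        Real.circleAverage (fun z => Real.log ‖G z‖) 0 r ≤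
      4 / 3 * Real.log (K * (k + 1) * A / δ ^ 2) := by
  obtain ⟨K₀, hK₀, hK⟩ := exists_circleAverage_rpow_le
  refine ⟨3 * K₀ + 20 + 1, by linarith, ?_⟩
  intro G G₁ k hG₁ h0 hG hnc r δ A hr hδ hδ1 hA hle
  obtain ⟨n, c, hn, hc⟩ := exists_norm_logDeriv_le hG₁ h0 hr hδ hδ1 hA hle
  have hGd : Differentiable ℂ G := by
    have : G = fun z => z ^ k * G₁ z := funext hG
    rw [this]; fun_prop
  have hG'd : Differentiable ℂ (deriv G) := fun x => ((hGd.analyticAt x).deriv).differentiableAt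
  obtain ⟨z₁, hz₁⟩ := hnc
  obtain ⟨z₀, hz₀⟩ : ∃ z, G z ≠ 0 := by
    by_contra hcon
    push Not at hcon
    apply hz₁
    have : G = fun _ => 0 := funext hcon
    rw [this]; simp
  set D : ℝ := k + 20 * A / δ ^ 2 with hD
  have hD0 : 0 ≤ D := by positivity
  -- By subadditivity of `t ↦ t ^ (3/4)`, `F` dominates `|z G' / G| ^ (3/4)`. Its circle average is
  -- at most `y`.
  set F : ℂ → ℝ := fun z => ∑ i, (r / ‖z - c i‖) ^ (3 / 4 : ℝ) + D ^ (3 / 4 : ℝ) with hF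
  have hFi : CircleIntegrable F 0 r := by
    refine CircleIntegrable.add ?_ (circleIntegrable_const _ _ _)
    exact CircleIntegrable.fun_sum _ fun i _ => (hK (c i) r hr).1
  have hFa : Real.circleAverage F 0 r ≤ n * K₀ + D ^ (3 / 4 : ℝ) := by
    rw [hF, Real.circleAverage_fun_add
      (CircleIntegrable.fun_sum _ fun i _ => (hK (c i) r hr).1) (circleIntegrable_const _ _ _),
      Real.circleAverage_fun_sum fun i _ => (hK (c i) r hr).1, Real.circleAverage_const]
    gcongr
    calc _ ≤ ∑ i : Fin n, K₀ := Finset.sum_le_sum fun i _ => (hK (c i) r hr).2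
      _ = n * K₀ := by simp
  set y : ℝ := (3 * K₀ + 20 + 1) * (k + 1) * A / δ ^ 2 with hy
  have hδ2 : δ ^ 2 ≤ δ := by nlinarith
  have hδ2' : δ ^ 2 ≤ 1 := by nlinarith
  have hAδ : 1 ≤ A / δ ^ 2 := by rw [le_div_iff₀ (by positivity)]; linarith
  have hy0 : 0 < y := by positivity
  have hFy : Real.circleAverage F 0 r ≤ y := by
    refine hFa.trans ?_
    have h1 : (n : ℝ) * K₀ ≤ 3 * (A / δ ^ 2) * K₀ := by
      have : 3 * A / δ ≤ 3 * A / δ ^ 2 := by gcongr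
      have : (n : ℝ) ≤ 3 * (A / δ ^ 2) := by rw [← mul_div_assoc]; exact hn.trans this
      gcongr
    have h2 : D ^ (3 / 4 : ℝ) ≤ D := by
      have h1D : 1 ≤ D := by
        rw [hD, mul_div_assoc]; nlinarith [Nat.cast_nonneg (α := ℝ) k]
      calc D ^ (3 / 4 : ℝ) ≤ D ^ (1 : ℝ) := Real.rpow_le_rpow_of_exponent_le h1D (by norm_num)
        _ = D := Real.rpow_one D
    have hk : (0 : ℝ) ≤ k := Nat.cast_nonneg k
    rw [hy, mul_div_assoc]
    rw [hD, mul_div_assoc] at h2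
    set q := A / δ ^ 2
    have : (0 : ℝ) ≤ k * q := by positivity
    have h3 : (k : ℝ) ≤ k * q := le_mul_of_one_le_right hk hAδ
    have h4 : 0 ≤ K₀ * (k * q) := by positivity
    rw [hD, mul_div_assoc]
    nlinarith
  have hi1 : CircleIntegrable (fun z => Real.log ‖z * deriv G z‖) 0 r :=
    MeromorphicOn.circleIntegrable_log_norm fun z _ =>
      ((differentiable_id.mul hG'd).analyticAt z).meromorphicAt
  have hi2 : CircleIntegrable (fun z => Real.log ‖G z‖) 0 r :=
    MeromorphicOn.circleIntegrable_log_norm fun z _ => (hGd.analyticAt z).meromorphicAt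
  rw [← Real.circleAverage_fun_sub hi1 hi2]
  have hgi : CircleIntegrable (fun z => (4 / 3 : ℝ) • (y⁻¹ • F z + (Real.log y - 1))) 0 r :=
    ((hFi.const_smul).add (circleIntegrable_const _ _ _)).const_smul
  have hmain := circleAverage_mono_of_countable hr.ne' (hi1.sub hi2) hgi
    ((countable_zeros hGd hz₀).union (countable_zeros hG'd hz₁)) (fun z hz hzS => by
      simp only [Set.mem_union, Set.mem_ofPred_eq, not_or] at hzS
      obtain ⟨hGz, hG'z⟩ := hzS
      rw [abs_of_pos hr] at hz
      have hzne : z ≠ 0 := by rw [← norm_pos_iff, hz]; exact hr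
      have hG₁z : G₁ z ≠ 0 := by
        intro h; apply hGz; rw [hG, h, mul_zero]
      have hquot : z * deriv G z / G z = k + z * deriv G₁ z / G₁ z := by
        have e : deriv G z = k * z ^ (k - 1) * G₁ z + z ^ k * deriv G₁ z := by
          have e1 : G = fun z => z ^ k * G₁ z := funext hG
          rw [e1]
          exact ((hasDerivAt_pow k z).mul (hG₁ z).hasDerivAt).deriv
        have e2 : z * (k * z ^ (k - 1)) = k * z ^ k := by
          rcases k with _ | k
          · simp
          · simp [pow_succ]; ring
        rw [hG z, e, mul_add, ← mul_assoc, e2]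
        field_simp
      have hb := hc z hz hG₁z
      have hq : ‖z * deriv G z / G z‖ ≤ ∑ i, r / ‖z - c i‖ + D := by
        rw [hquot]
        refine (norm_add_le _ _).trans ?_
        rw [hD, Complex.norm_natCast]
        linarith
      have hqpos : 0 < ‖z * deriv G z / G z‖ :=
        norm_pos_iff.2 (div_ne_zero (mul_ne_zero hzne hG'z) hGz)
      have hqF : ‖z * deriv G z / G z‖ ^ (3 / 4 : ℝ) ≤ F z := by
        refine (Real.rpow_le_rpow hqpos.le hq (by norm_num)).trans ?_
        refine (Real.rpow_add_le_add_rpow (Finset.sum_nonneg fun i _ => by positivity) hD0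
          (by norm_num) (by norm_num)).trans ?_
        exact add_le_add_left (rpow_sum_le _ fun i => by positivity) _
      -- The tangent line of `log` at `y` takes the place of Jensen's inequality for concave
      -- functions: averaging gives `log y`, and undoing the power `3/4` gives the factor `4/3`.
      have hlog : Real.log (‖z * deriv G z / G z‖ ^ (3 / 4 : ℝ)) ≤
          y⁻¹ * F z + (Real.log y - 1) := by
        have hp : 0 < ‖z * deriv G z / G z‖ ^ (3 / 4 : ℝ) := Real.rpow_pos_of_pos hqpos _
        have h1 := Real.log_le_sub_one_of_pos (div_pos hp hy0)
        rw [Real.log_div hp.ne' hy0.ne'] at h1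
        have h2 : ‖z * deriv G z / G z‖ ^ (3 / 4 : ℝ) / y ≤ y⁻¹ * F z := by
          rw [div_eq_inv_mul]; gcongr
        linarith
      rw [Real.log_rpow hqpos, norm_div, Real.log_div (norm_ne_zero_iff.2 (mul_ne_zero hzne hG'z))
        (norm_ne_zero_iff.2 hGz)] at hlog
      simp only [Pi.sub_apply, smul_eq_mul]
      linarith)
  refine hmain.trans ?_
  rw [Real.circleAverage_fun_smul (a := (4 / 3 : ℝ)) (f := fun z => y⁻¹ • F z + (Real.log y - 1)),
    Real.circleAverage_fun_add (f₁ := fun z => y⁻¹ • F z) (f₂ := fun _ => Real.log y - 1)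
      hFi.const_smul (circleIntegrable_const _ _ _),
    Real.circleAverage_fun_smul, Real.circleAverage_const, smul_eq_mul, smul_eq_mul]
  have : y⁻¹ * Real.circleAverage F 0 r ≤ 1 := by
    rw [← div_eq_inv_mul, div_le_one hy0]; exact hFy
  linarith

/-! ### Borel's growth lemma. -/

lemma setLIntegral_inv_Icc_le {τ d : ℝ} (hd : 0 ≤ d) :
    ∫⁻ r in Set.Icc (τ / (1 + d)) τ ∩ Set.Ioi 0, ENNReal.ofReal (1 / r) ≤ ENNReal.ofReal d := by
  rcases le_or_gt τ 0 with hτ | hτ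
  · have : Set.Icc (τ / (1 + d)) τ ∩ Set.Ioi 0 = ∅ := by
      ext r
      simp only [Set.mem_inter_iff, Set.mem_Icc, Set.mem_Ioi, Set.mem_empty_iff_false, iff_false]
      rintro ⟨⟨_, h1⟩, h2⟩
      linarith
    simp [this]
  · have hpos : 0 < τ / (1 + d) := by positivity
    calc ∫⁻ r in Set.Icc (τ / (1 + d)) τ ∩ Set.Ioi 0, ENNReal.ofReal (1 / r)
        ≤ ∫⁻ r in Set.Icc (τ / (1 + d)) τ, ENNReal.ofReal (1 / r) :=
          lintegral_mono_set Set.inter_subset_left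
      _ ≤ ∫⁻ _ in Set.Icc (τ / (1 + d)) τ, ENNReal.ofReal (1 / (τ / (1 + d))) := by
          refine setLIntegral_mono measurable_const fun r hr => ?_
          exact ENNReal.ofReal_le_ofReal (one_div_le_one_div_of_le hpos hr.1)
      _ = ENNReal.ofReal (1 / (τ / (1 + d))) * ENNReal.ofReal (τ - τ / (1 + d)) := by
          rw [setLIntegral_const, Real.volume_Icc]
      _ = ENNReal.ofReal d := by
          rw [← ENNReal.ofReal_mul (by positivity)]
          congr 1
          field_simp
          ring

/-- Borel's growth lemma, for the logarithmic measure. -/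
theorem exists_hasFiniteLogMeasure_growth {T : ℝ → ℝ} (hT : MonotoneOn T (Set.Ioi 0))
    (htop : Tendsto T atTop atTop) :
    ∃ E : Set ℝ, HasFiniteLogMeasure E ∧ ∀ᶠ r in atTop, r ∉ E →
      T (r * (1 + (1 + Real.log (T r)) ^ (-(5 / 4) : ℝ))) ≤ Real.exp 1 * T r := by
  set S : ℕ → Set ℝ := fun n => {r | 0 < r ∧ T r < Real.exp (n + 1)} with hS
  -- The exponent `5/4` exceeds `1`, so the `d n`, which bound the logarithmic lengths of the
  -- exceptional intervals, are summable.
  set d : ℕ → ℝ := fun n => ((n : ℝ) + 1) ^ (-(5 / 4) : ℝ) with hd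
  have hd0 : ∀ n, 0 ≤ d n := fun n => by positivity
  have hsum : Summable d := by
    have h1 : Summable fun n : ℕ => (n : ℝ) ^ (-(5 / 4) : ℝ) :=
      Real.summable_nat_rpow.2 (by norm_num)
    have := (summable_nat_add_iff 1).2 h1
    simpa [hd] using this
  refine ⟨⋃ n, Set.Icc (sSup (S n) / (1 + d n)) (sSup (S n)) ∩ Set.Ioi 0, ⟨?_, ?_, ?_⟩, ?_⟩
  · exact MeasurableSet.iUnion fun n => measurableSet_Icc.inter measurableSet_Ioi
  · exact Set.iUnion_subset fun n => Set.inter_subset_right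
  · refine (lintegral_iUnion_le _ _).trans_lt ?_
    refine (ENNReal.tsum_le_tsum fun n => setLIntegral_inv_Icc_le (hd0 n)).trans_lt ?_
    exact hsum.tsum_ofReal_lt_top
  · filter_upwards [eventually_gt_atTop 0, htop.eventually_ge_atTop 1] with r hr hTr hrE
    by_contra hcon
    push Not at hcon
    apply hrE
    have hlog : 0 ≤ Real.log (T r) := Real.log_nonneg hTr
    set n := ⌊Real.log (T r)⌋₊ with hn
    have hn1 : (n : ℝ) ≤ Real.log (T r) := Nat.floor_le hlog
    have hn2 : Real.log (T r) < n + 1 := Nat.lt_floor_add_one _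
    have hexp : Real.exp n ≤ T r := (Real.le_log_iff_exp_le (by linarith)).1 hn1
    have hexp' : T r < Real.exp (n + 1) := (Real.log_lt_iff_lt_exp (by linarith)).1 hn2
    have hδ : (1 + Real.log (T r)) ^ (-(5 / 4) : ℝ) ≤ d n :=
      Real.rpow_le_rpow_of_nonpos (by positivity) (by linarith) (by norm_num)
    have hδ0 : 0 ≤ (1 + Real.log (T r)) ^ (-(5 / 4) : ℝ) := by positivity
    have hbig : Real.exp (n + 1) < T (r * (1 + d n)) := by
      refine lt_of_lt_of_le ?_ (hT (by simp only [Set.mem_Ioi]; positivity)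
        (by have := hd0 n; simp only [Set.mem_Ioi]; positivity)
        (by gcongr : r * (1 + (1 + Real.log (T r)) ^ (-(5 / 4) : ℝ)) ≤ r * (1 + d n)))
      refine lt_of_le_of_lt ?_ hcon
      rw [add_comm, Real.exp_add]
      gcongr
    -- If growth fails at `r`, then `T` has passed `exp (n + 1)` by `r (1 + d n)`, so `r` lies
    -- within the factor `1 + d n` below `sSup (S n)`.
    have hub : ∀ s ∈ S n, s ≤ r * (1 + d n) := by
      rintro s ⟨hs0, hs⟩
      by_contra hlt
      push Not at hlt
      have := hT (by have := hd0 n; simp only [Set.mem_Ioi]; positivity) hs0 hlt.le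
      linarith
    have hrS : r ∈ S n := ⟨hr, hexp'⟩
    refine Set.mem_iUnion.2 ⟨n, ⟨?_, ?_⟩, hr⟩
    · rw [div_le_iff₀ (by have := hd0 n; positivity)]
      exact csSup_le ⟨r, hrS⟩ hub
    · exact le_csSup ⟨_, hub⟩ hrS

lemma HasFiniteLogMeasure.union {E F : Set ℝ} (hE : HasFiniteLogMeasure E)
    (hF : HasFiniteLogMeasure F) : HasFiniteLogMeasure (E ∪ F) := by
  refine ⟨hE.1.union hF.1, Set.union_subset hE.2.1 hF.2.1, ?_⟩
  exact (lintegral_union_le _ _ _).trans_lt (ENNReal.add_lt_top.2 ⟨hE.2.2, hF.2.2⟩)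

/-! ### Power series -/

section PowerSeries

variable {f : ℂ → ℂ} {c : ℕ → ℂ}

lemma hasFPowerSeriesOnBall_ofScalars (hc : ∀ z : ℂ, HasSum (fun j => c j * z ^ j) (f z)) :
    HasFPowerSeriesOnBall f (FormalMultilinearSeries.ofScalars ℂ c) 0 ⊤ := by
  have hs : ∀ z : ℂ, HasSum (fun n => FormalMultilinearSeries.ofScalars ℂ c n fun _ => z) (f z) := by
    intro z
    convert hc z using 2 with n
    rw [FormalMultilinearSeries.ofScalars_apply_eq, smul_eq_mul]
  refine ⟨?_, by simp, fun {y} _ => by simpa using hs y⟩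
  rw [FormalMultilinearSeries.radius_eq_top_of_summable_norm]
  intro r
  have := (hs (r : ℂ)).summable.norm
  refine this.congr fun n => ?_
  rw [FormalMultilinearSeries.ofScalars_apply_eq, smul_eq_mul, norm_mul, norm_pow,
    FormalMultilinearSeries.ofScalars_norm, Complex.norm_real, NNReal.norm_eq]

/-- Cauchy's estimate for the coefficients of an everywhere convergent power series. -/
lemma norm_coeff_mul_pow_le (hc : ∀ z : ℂ, HasSum (fun j => c j * z ^ j) (f z)) {r M : ℝ}
    (hr : 0 < r) (hM : ∀ z, ‖z‖ = r → ‖f z‖ ≤ M) (j : ℕ) : ‖c j‖ * r ^ j ≤ M := by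
  have hp := hasFPowerSeriesOnBall_ofScalars hc
  have hd : Differentiable ℂ f := fun z =>
    (hp.analyticAt_of_mem (by simp)).differentiableAt
  lift r to ℝ≥0 using hr.le
  have hq := hd.diffContOnCl (s := Metric.ball 0 r) |>.hasFPowerSeriesOnBall (R := r)
    (by exact_mod_cast hr)
  have e := hp.hasFPowerSeriesAt.eq_formalMultilinearSeries hq.hasFPowerSeriesAt
  have h1 : ‖c j‖ = ‖cauchyPowerSeries f 0 r j‖ := by
    rw [← e, FormalMultilinearSeries.ofScalars_norm]
  have h2 := norm_cauchyPowerSeries_le f 0 r j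
  have h3 : (2 * Real.pi)⁻¹ * ∫ θ in (0 : ℝ)..2 * Real.pi, ‖f (circleMap 0 r θ)‖ ≤ M := by
    have := Real.circleAverage_mono_on_of_le_circle (f := fun z => ‖f z‖) (c := 0) (R := r) (a := M)
      (hd.continuous.norm.continuousOn.circleIntegrable hr.le)
      (fun z hz => hM z (by simpa using hz))
    rwa [Real.circleAverage_def, smul_eq_mul] at this
  rw [h1]
  calc ‖cauchyPowerSeries f 0 r j‖ * (r : ℝ) ^ j
      ≤ (M * |(r : ℝ)|⁻¹ ^ j) * (r : ℝ) ^ j := by gcongr; exact h2.trans (by gcongr)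
    _ = M := by
      rw [abs_of_pos hr, mul_assoc, ← mul_pow, inv_mul_cancel₀ hr.ne', one_pow, mul_one]

lemma summable_sq_mul_pow {x : ℝ} (hx0 : 0 ≤ x) (hx1 : x < 1) :
    Summable (fun j : ℕ => ((j : ℝ) + 1) ^ 2 * x ^ j) ∧
      ∑' j : ℕ, ((j : ℝ) + 1) ^ 2 * x ^ j ≤ 2 / (1 - x) ^ 3 := by
  have hn : ‖x‖ < 1 := by rwa [Real.norm_of_nonneg hx0]
  have h1 := summable_choose_mul_geometric_of_norm_lt_one 2 hn
  have h2 := tsum_choose_mul_geometric_of_norm_lt_one 2 hn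
  have hle : ∀ j : ℕ, ((j : ℝ) + 1) ^ 2 * x ^ j ≤ 2 * (((j + 2).choose 2 : ℕ) * x ^ j) := by
    intro j
    rw [← mul_assoc]
    gcongr
    rw [Nat.cast_choose_two]
    push_cast
    have := Nat.cast_nonneg (α := ℝ) j
    nlinarith
  have hs : Summable (fun j : ℕ => ((j : ℝ) + 1) ^ 2 * x ^ j) :=
    Summable.of_nonneg_of_le (fun j => by positivity) hle (h1.mul_left 2)
  refine ⟨hs, ?_⟩
  calc _ ≤ ∑' j : ℕ, 2 * (((j + 2).choose 2 : ℕ) * x ^ j) := hs.tsum_le_tsum hle (h1.mul_left 2)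
    _ = 2 / (1 - x) ^ 3 := by rw [tsum_mul_left, h2]; ring

/-- The weighted square sum of the coefficients at radius `r` is bounded by the maximum modulus at
the slightly larger radius `r (1 + δ)`. -/
lemma tsum_sq_mul_coeff_le (hc : ∀ z : ℂ, HasSum (fun j => c j * z ^ j) (f z)) {r δ M : ℝ}
    (hr : 0 < r) (hδ : 0 < δ) (hδ1 : δ ≤ 1) (hM : ∀ z, ‖z‖ = r * (1 + δ) → ‖f z‖ ≤ M) :
    Summable (fun j : ℕ => ((j : ℝ) + 1) ^ 2 * (‖c j‖ ^ 2 * r ^ (2 * j))) ∧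
      ∑' j : ℕ, ((j : ℝ) + 1) ^ 2 * (‖c j‖ ^ 2 * r ^ (2 * j)) ≤ 16 * M ^ 2 / δ ^ 3 := by
  -- Cauchy's estimate at radius `r (1 + δ)` leaves a geometric factor `x ^ j`. As `1 - x ≥ δ / 2`,
  -- the weighted series is at most `2 / (δ / 2)³`.
  set x : ℝ := ((1 + δ)⁻¹) ^ 2 with hx
  have hx0 : 0 ≤ x := by positivity
  have hxle : x ≤ (1 + δ)⁻¹ := by
    have h1 : (1 + δ)⁻¹ ≤ 1 := inv_le_one_of_one_le₀ (by linarith)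
    have h0 : 0 ≤ (1 + δ)⁻¹ := by positivity
    rw [hx]; nlinarith
  have hxδ : δ / 2 ≤ 1 - x := by
    have : (1 + δ)⁻¹ ≤ 1 - δ / 2 := by
      rw [inv_le_iff_one_le_mul₀ (by positivity)]; nlinarith
    linarith
  have hx1 : x < 1 := by linarith
  obtain ⟨hs, ht⟩ := summable_sq_mul_pow hx0 hx1
  have hle : ∀ j : ℕ, ((j : ℝ) + 1) ^ 2 * (‖c j‖ ^ 2 * r ^ (2 * j)) ≤
      M ^ 2 * (((j : ℝ) + 1) ^ 2 * x ^ j) := by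
    intro j
    have h1 := norm_coeff_mul_pow_le hc (by positivity : 0 < r * (1 + δ)) hM j
    have h2 : (‖c j‖ * (r * (1 + δ)) ^ j) ^ 2 ≤ M ^ 2 := by gcongr
    have h3 : ‖c j‖ ^ 2 * r ^ (2 * j) = (‖c j‖ * (r * (1 + δ)) ^ j) ^ 2 * x ^ j := by
      have e1 : x ^ j = (((1 + δ) ^ j) ^ 2)⁻¹ := by
        rw [hx, inv_pow, inv_pow, ← pow_mul, ← pow_mul, mul_comm]
      rw [e1, mul_comm 2 j, pow_mul, mul_pow r]
      field_simp
    rw [h3]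
    have : 0 ≤ ((j : ℝ) + 1) ^ 2 * x ^ j := by positivity
    nlinarith
  have hs' : Summable (fun j : ℕ => ((j : ℝ) + 1) ^ 2 * (‖c j‖ ^ 2 * r ^ (2 * j))) :=
    Summable.of_nonneg_of_le (fun j => by positivity) hle (hs.mul_left _)
  refine ⟨hs', ?_⟩
  calc _ ≤ ∑' j : ℕ, M ^ 2 * (((j : ℝ) + 1) ^ 2 * x ^ j) := hs'.tsum_le_tsum hle (hs.mul_left _)
    _ = M ^ 2 * ∑' j : ℕ, ((j : ℝ) + 1) ^ 2 * x ^ j := tsum_mul_left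
    _ ≤ M ^ 2 * (2 / (δ / 2) ^ 3) := by
        gcongr
        refine ht.trans ?_
        gcongr
    _ = 16 * M ^ 2 / δ ^ 3 := by field_simp; ring

end PowerSeries

/-- The Cauchy–Schwarz inequality for series. -/
lemma summable_mul_and_tsum_le_sqrt {u v : ℕ → ℝ} (hu0 : ∀ j, 0 ≤ u j) (hv0 : ∀ j, 0 ≤ v j)
    (hu : Summable fun j => u j ^ 2) (hv : Summable fun j => v j ^ 2) :
    Summable (fun j => u j * v j) ∧
      ∑' j, u j * v j ≤ Real.sqrt (∑' j, u j ^ 2) * Real.sqrt (∑' j, v j ^ 2) := by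
  have h := Real.summable_and_inner_le_Lp_mul_Lq_tsum_of_nonneg (p := 2) (q := 2)
    (Real.HolderConjugate.two_two) hu0 hv0 (by simpa using hu) (by simpa using hv)
  simpa [Real.sqrt_eq_rpow] using h

section PowerSeries

variable {f : ℂ → ℂ} {c : ℕ → ℂ}

lemma differentiable_of_hasSum (hc : ∀ z : ℂ, HasSum (fun j => c j * z ^ j) (f z)) :
    Differentiable ℂ f := fun z =>
  ((hasFPowerSeriesOnBall_ofScalars hc).analyticAt_of_mem (by simp)).differentiableAt

lemma norm_le_maxModulus (hf : Continuous f) {z : ℂ} {r : ℝ} (hz : ‖z‖ = r) :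
    ‖f z‖ ≤ maxModulus f r := by
  refine le_csSup ?_ ⟨z, by simpa using hz, rfl⟩
  exact ((isCompact_sphere (0 : ℂ) r).image hf.norm).bddAbove

lemma maxModulus_le {r K : ℝ} (hr : 0 ≤ r) (h : ∀ z, ‖z‖ = r → ‖f z‖ ≤ K) :
    maxModulus f r ≤ K := by
  refine csSup_le ?_ ?_
  · exact ⟨_, (r : ℂ), by simp [abs_of_nonneg hr], rfl⟩
  · rintro _ ⟨z, hz, rfl⟩
    exact h z (by simpa using hz)

lemma norm_le_maxModulus_of_le (hf : Differentiable ℂ f) {z : ℂ} {r : ℝ} (hr : 0 < r)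
    (hz : ‖z‖ ≤ r) : ‖f z‖ ≤ maxModulus f r := by
  refine Complex.norm_le_of_forall_mem_frontier_norm_le (U := Metric.ball 0 r)
    Metric.isBounded_ball hf.diffContOnCl ?_ (z := z) ?_
  · intro w hw
    rw [frontier_ball _ hr.ne', mem_sphere_zero_iff_norm] at hw
    exact norm_le_maxModulus hf.continuous hw
  · rw [closure_ball _ hr.ne']; simpa using hz

lemma maxModulus_monotoneOn (hf : Differentiable ℂ f) :
    MonotoneOn (maxModulus f) (Set.Ioi 0) := by
  intro r hr s hs hrs
  exact maxModulus_le (le_of_lt hr) fun z hz => norm_le_maxModulus_of_le hf hs (hz.le.trans hrs)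

/-- A transcendental entire function has infinitely many nonzero Taylor coefficients. -/
lemma IsTranscendentalEntire.infinite_coeff (hf : IsTranscendentalEntire f)
    (hc : ∀ z : ℂ, HasSum (fun j => c j * z ^ j) (f z)) : {j | c j ≠ 0}.Infinite := by
  intro hfin
  refine hf.2 ⟨∑ j ∈ hfin.toFinset, Polynomial.monomial j (c j), fun z => ?_⟩
  have h1 : HasSum (fun j => c j * z ^ j) (∑ j ∈ hfin.toFinset, c j * z ^ j) := by
    refine hasSum_sum_of_ne_finset_zero fun j hj => ?_
    have : c j = 0 := by simpa using hj
    simp [this]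
  rw [(hc z).unique h1, Polynomial.eval_finsetSum]
  simp

lemma tendsto_maxModulus (hc : ∀ z : ℂ, HasSum (fun j => c j * z ^ j) (f z)) {j : ℕ}
    (hj : j ≠ 0) (hcj : c j ≠ 0) : Tendsto (maxModulus f) atTop atTop := by
  have h1 : Tendsto (fun r : ℝ => ‖c j‖ * r ^ j) atTop atTop :=
    (tendsto_pow_atTop hj).const_mul_atTop (norm_pos_iff.2 hcj)
  refine tendsto_atTop_mono' _ ?_ h1
  filter_upwards [eventually_gt_atTop 0] with r hr
  exact norm_coeff_mul_pow_le hc hr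
    (fun z hz => norm_le_maxModulus (differentiable_of_hasSum hc).continuous hz) j

lemma summable_sq_mul_coeff (hc : ∀ z : ℂ, HasSum (fun j => c j * z ^ j) (f z)) (r : ℝ) :
    Summable (fun j : ℕ => ((j : ℝ) + 1) ^ 2 * (‖c j‖ ^ 2 * r ^ (2 * j))) := by
  have hcont := (differentiable_of_hasSum hc).continuous
  have h := (tsum_sq_mul_coeff_le hc (r := |r| + 1) (δ := 1) (by positivity) one_pos le_rfl
    (fun z hz => norm_le_maxModulus hcont hz)).1
  refine Summable.of_nonneg_of_le (fun j => ?_) (fun j => ?_) h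
  · rw [pow_mul]; positivity
  · rw [pow_mul r, pow_mul (|r| + 1), ← sq_abs r]
    gcongr
    linarith

lemma summable_sq_mul_starCoeff (hc : ∀ z : ℂ, HasSum (fun j => c j * z ^ j) (f z)) (r : ℝ) :
    Summable (fun j : ℕ => ((j : ℝ) + 1) ^ 2 * (‖starCoeff c j‖ ^ 2 * r ^ (2 * j))) := by
  have h := summable_sq_mul_coeff hc (2 * r)
  refine Summable.of_nonneg_of_le (fun j => ?_) (fun j => ?_) h
  · rw [pow_mul]; positivity
  · rw [starCoeff, norm_mul, Complex.norm_natCast, mul_pow, mul_pow]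
    have h1 : (j : ℝ) ^ 2 ≤ 2 ^ (2 * j) := by
      rw [mul_comm, pow_mul]
      gcongr
      exact_mod_cast Nat.lt_two_pow_self.le
    have h2 : 0 ≤ r ^ (2 * j) := by rw [pow_mul]; positivity
    have h3 : 0 ≤ ‖c j‖ ^ 2 * r ^ (2 * j) := by positivity
    have : (j : ℝ) ^ 2 * ‖c j‖ ^ 2 * r ^ (2 * j) ≤ ‖c j‖ ^ 2 * (2 ^ (2 * j) * r ^ (2 * j)) := by
      nlinarith
    gcongr

lemma summable_sigma_terms {b : ℕ → ℂ}
    (hb : ∀ r : ℝ, Summable (fun j : ℕ => ((j : ℝ) + 1) ^ 2 * (‖b j‖ ^ 2 * r ^ (2 * j)))) (r : ℝ) :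
    Summable (fun j : ℕ => ‖b j‖ ^ 2 * r ^ (2 * j)) := by
  refine Summable.of_nonneg_of_le (fun j => ?_) (fun j => ?_) (hb r)
  · rw [pow_mul]; positivity
  · have h1 : 0 ≤ ‖b j‖ ^ 2 * r ^ (2 * j) := by rw [pow_mul]; positivity
    have h2 : (1 : ℝ) ≤ ((j : ℝ) + 1) ^ 2 := one_le_pow₀ (by linarith [Nat.cast_nonneg (α := ℝ) j])
    nlinarith

/-! ### Growth of `sigma`. -/

section Sigma

variable {b : ℕ → ℂ} (hb : ∀ r : ℝ, Summable (fun j : ℕ => ‖b j‖ ^ 2 * r ^ (2 * j)))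

include hb

lemma coeff_mul_pow_le_sigma {r : ℝ} (hr : 0 ≤ r) (j : ℕ) : ‖b j‖ * r ^ j ≤ sigma b r := by
  refine Real.le_sqrt_of_sq_le ?_
  have := (hb r).le_tsum j (fun i _ => by positivity)
  refine le_trans (le_of_eq ?_) this
  rw [mul_pow, ← pow_mul, mul_comm j 2]

lemma sigma_pos {r : ℝ} (hr : 0 < r) {j : ℕ} (hj : b j ≠ 0) : 0 < sigma b r := by
  refine lt_of_lt_of_le ?_ (coeff_mul_pow_le_sigma hb hr.le j)
  have := norm_pos_iff.2 hj
  positivity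

lemma sigma_mono {r s : ℝ} (hr : 0 ≤ r) (hrs : r ≤ s) : sigma b r ≤ sigma b s := by
  refine Real.sqrt_le_sqrt ((hb r).tsum_le_tsum (fun j => ?_) (hb s))
  gcongr

lemma continuous_sigma : Continuous (sigma b) := by
  refine Real.continuous_sqrt.comp ?_
  rw [continuous_iff_continuousAt]
  intro r
  have h : ContinuousOn (fun r : ℝ => ∑' j, ‖b j‖ ^ 2 * r ^ (2 * j))
      (Metric.closedBall 0 (|r| + 1)) := by
    refine continuousOn_tsum (fun j => by fun_prop) (hb (|r| + 1)) ?_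
    intro j x hx
    rw [norm_mul, norm_pow, norm_pow, norm_norm]
    gcongr
    simpa using hx
  refine h.continuousAt (Metric.closedBall_mem_nhds_of_mem ?_)
  simp

lemma tendsto_sigma {j : ℕ} (hj : j ≠ 0) (hbj : b j ≠ 0) : Tendsto (sigma b) atTop atTop := by
  have h1 : Tendsto (fun r : ℝ => ‖b j‖ * r ^ j) atTop atTop :=
    (tendsto_pow_atTop hj).const_mul_atTop (norm_pos_iff.2 hbj)
  refine tendsto_atTop_mono' _ ?_ h1
  filter_upwards [eventually_ge_atTop 0] with r hr
  exact coeff_mul_pow_le_sigma hb hr j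

/-- Radii at which `σ` takes the values `exp n`. -/
lemma exists_seq_sigma_eq_exp {j : ℕ} (hj : j ≠ 0) (hbj : b j ≠ 0) :
    ∃ ρ : ℕ → ℝ, Tendsto ρ atTop atTop ∧ (∀ n, 0 < ρ n) ∧
      ∀ᶠ n in atTop, sigma b (ρ n) = Real.exp n := by
  have ht := tendsto_sigma hb hj hbj
  -- The intermediate value theorem applies once `exp n ≥ σ(1)`; for smaller `n` the radius is the
  -- default `1`.
  have hex : ∀ n : ℕ, ∃ r : ℝ, 1 ≤ r ∧ (sigma b 1 ≤ Real.exp n → sigma b r = Real.exp n) := by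
    intro n
    by_cases h : sigma b 1 ≤ Real.exp n
    · obtain ⟨R, hR1, hR⟩ := ((eventually_ge_atTop 1).and
        (ht.eventually_ge_atTop (Real.exp n))).exists
      obtain ⟨r, hr, hr'⟩ := intermediate_value_Icc hR1 (continuous_sigma hb).continuousOn ⟨h, hR⟩
      exact ⟨r, hr.1, fun _ => hr'⟩
    · exact ⟨1, le_rfl, fun h' => absurd h' h⟩
  choose ρ hρ1 hρ using hex
  have hexp : Tendsto (fun n : ℕ => Real.exp n) atTop atTop :=
    Real.tendsto_exp_atTop.comp tendsto_natCast_atTop_atTop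
  have hev : ∀ᶠ n : ℕ in atTop, sigma b (ρ n) = Real.exp n := by
    filter_upwards [hexp.eventually_ge_atTop (sigma b 1)] with n hn using hρ n hn
  refine ⟨ρ, ?_, fun n => one_pos.trans_le (hρ1 n), hev⟩
  refine tendsto_atTop.2 fun R => ?_
  filter_upwards [hev, hexp.eventually_gt_atTop (sigma b R)] with n h1 h2
  by_contra hlt
  push Not at hlt
  have := sigma_mono hb (zero_le_one.trans (hρ1 n)) hlt.le
  linarith

end Sigma

/-- `M(r, f) ≤ |c₀| + K σ*(r)`. -/
lemma exists_maxModulus_le_sigma (hc : ∀ z : ℂ, HasSum (fun j => c j * z ^ j) (f z)) :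
    ∃ K : ℝ, 0 < K ∧ ∀ r : ℝ, 0 < r →
      maxModulus f r ≤ ‖c 0‖ + K * sigma (starCoeff c) r := by
  -- Cauchy–Schwarz, splitting each coefficient of index `j + 1` as `1 / (j + 1)` times a
  -- coefficient of `f*`. No power of `log M` is lost; `c 0` is invisible to `σ*` and is kept apart.
  set u : ℕ → ℝ := fun j => 1 / ((j : ℝ) + 1) with hu
  have hus : Summable fun j => u j ^ 2 := by
    have := (summable_nat_add_iff 1).2 (Real.summable_one_div_nat_pow.2 one_lt_two)
    refine this.congr fun j => ?_
    rw [hu]; push_cast; rw [div_pow, one_pow]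
  refine ⟨Real.sqrt (∑' j, u j ^ 2) + 1, by positivity, fun r hr => ?_⟩
  have hσ := summable_sigma_terms (summable_sq_mul_starCoeff hc)
  refine maxModulus_le hr.le fun z hz => ?_
  set v : ℕ → ℝ := fun j => ‖starCoeff c (j + 1)‖ * r ^ (j + 1) with hv
  have hv2 : ∀ j, v j ^ 2 = ‖starCoeff c (j + 1)‖ ^ 2 * r ^ (2 * (j + 1)) := by
    intro j; rw [hv]; ring
  have hvs : Summable fun j => v j ^ 2 := by
    simp_rw [hv2]
    exact (summable_nat_add_iff 1).2 (hσ r)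
  have hvle : Real.sqrt (∑' j, v j ^ 2) ≤ sigma (starCoeff c) r := by
    refine Real.sqrt_le_sqrt ?_
    simp_rw [hv2]
    rw [(hσ r).tsum_eq_zero_add]
    have : 0 ≤ ‖starCoeff c 0‖ ^ 2 * r ^ (2 * 0) := by positivity
    linarith
  obtain ⟨hs, hle⟩ := summable_mul_and_tsum_le_sqrt (u := u) (v := v) (fun j => by positivity)
    (fun j => by positivity) hus hvs
  have huv : ∀ j, u j * v j = ‖c (j + 1) * z ^ (j + 1)‖ := by
    intro j
    rw [hu, hv]
    simp only [starCoeff]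
    rw [norm_mul, norm_mul, Complex.norm_natCast, norm_pow, hz]
    push_cast
    field_simp
  rw [← (hc z).tsum_eq, (hc z).summable.tsum_eq_zero_add]
  refine (norm_add_le _ _).trans ?_
  have h1 : ‖∑' j, c (j + 1) * z ^ (j + 1)‖ ≤ ∑' j, u j * v j := by
    simp_rw [huv] at hs ⊢
    exact norm_tsum_le_tsum_norm hs
  have h2 : 0 ≤ sigma (starCoeff c) r := Real.sqrt_nonneg _
  have h3 : Real.sqrt (∑' j, u j ^ 2) * Real.sqrt (∑' j, v j ^ 2) ≤
      Real.sqrt (∑' j, u j ^ 2) * sigma (starCoeff c) r := by gcongr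
  simp only [pow_zero, mul_one]
  linarith

lemma sqrt_tsum_sq_mul_coeff_le (hc : ∀ z : ℂ, HasSum (fun j => c j * z ^ j) (f z)) {r δ : ℝ}
    (hr : 0 < r) (hδ : 0 < δ) (hδ1 : δ ≤ 1) :
    Real.sqrt (∑' j : ℕ, ((j : ℝ) + 1) ^ 2 * (‖c j‖ ^ 2 * r ^ (2 * j))) ≤
      4 * maxModulus f (r * (1 + δ)) * δ ^ (-(3 / 2) : ℝ) := by
  have hcont := (differentiable_of_hasSum hc).continuous
  have hle := (tsum_sq_mul_coeff_le hc hr hδ hδ1 (fun z hz => norm_le_maxModulus hcont hz)).2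
  have hM : 0 ≤ maxModulus f (r * (1 + δ)) :=
    (norm_nonneg _).trans (norm_le_maxModulus hcont (z := ((r * (1 + δ) : ℝ) : ℂ))
      (by rw [Complex.norm_real, Real.norm_of_nonneg (by positivity)]))
  refine Real.sqrt_le_iff.2 ⟨by positivity, hle.trans_eq ?_⟩
  have e : (δ ^ (-(3 / 2) : ℝ)) ^ 2 = (δ ^ 3)⁻¹ := by
    rw [← Real.rpow_natCast, ← Real.rpow_mul hδ.le, ← Real.rpow_natCast δ 3, ← Real.rpow_neg hδ.le]
    norm_num
  rw [mul_pow, mul_pow, e]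
  ring

/-- Bound of `σ*` by the maximum modulus at a slightly larger radius. -/
lemma sigma_starCoeff_le (hc : ∀ z : ℂ, HasSum (fun j => c j * z ^ j) (f z)) {r δ : ℝ}
    (hr : 0 < r) (hδ : 0 < δ) (hδ1 : δ ≤ 1) :
    sigma (starCoeff c) r ≤ 4 * maxModulus f (r * (1 + δ)) * δ ^ (-(3 / 2) : ℝ) := by
  refine le_trans (Real.sqrt_le_sqrt ?_) (sqrt_tsum_sq_mul_coeff_le hc hr hδ hδ1)
  refine (summable_sigma_terms (summable_sq_mul_starCoeff hc) r).tsum_le_tsum (fun j => ?_)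
    (summable_sq_mul_coeff hc r)
  rw [starCoeff, norm_mul, Complex.norm_natCast, mul_pow, mul_assoc]
  gcongr
  linarith

/-! ### Power series with perturbed coefficients -/

section Perturbed

variable {x : ℕ → ℂ} (hx : Summable fun j : ℕ => ‖x j‖ ^ 2 / ((j : ℝ) + 1) ^ 2)

include hx

/-- Cauchy–Schwarz with the weight `j + 1` moved from `x` to `b`. Here `x` stands for one sample of
the `χ j`. -/
lemma summable_norm_perturbed {b : ℕ → ℂ}
    (hb : ∀ r : ℝ, Summable (fun j : ℕ => ((j : ℝ) + 1) ^ 2 * (‖b j‖ ^ 2 * r ^ (2 * j)))) (z : ℂ) :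
    Summable (fun j => ‖x j * b j * z ^ j‖) ∧ ‖∑' j, x j * b j * z ^ j‖ ≤
      Real.sqrt (∑' j : ℕ, ‖x j‖ ^ 2 / ((j : ℝ) + 1) ^ 2) *
        Real.sqrt (∑' j : ℕ, ((j : ℝ) + 1) ^ 2 * (‖b j‖ ^ 2 * ‖z‖ ^ (2 * j))) := by
  have e1 : ∀ j : ℕ, (‖x j‖ / ((j : ℝ) + 1)) ^ 2 = ‖x j‖ ^ 2 / ((j : ℝ) + 1) ^ 2 :=
    fun j => div_pow _ _ _
  have e2 : ∀ j : ℕ, (((j : ℝ) + 1) * (‖b j‖ * ‖z‖ ^ j)) ^ 2 =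
      ((j : ℝ) + 1) ^ 2 * (‖b j‖ ^ 2 * ‖z‖ ^ (2 * j)) := fun j => by ring
  have h := summable_mul_and_tsum_le_sqrt (u := fun j : ℕ => ‖x j‖ / ((j : ℝ) + 1))
    (v := fun j : ℕ => ((j : ℝ) + 1) * (‖b j‖ * ‖z‖ ^ j)) (fun j => by positivity)
    (fun j => by positivity) (by simpa only [e1] using hx) (by simpa only [e2] using hb ‖z‖)
  simp only [e1, e2] at h
  have e3 : ∀ j : ℕ, ‖x j‖ / ((j : ℝ) + 1) * (((j : ℝ) + 1) * (‖b j‖ * ‖z‖ ^ j)) =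
      ‖x j * b j * z ^ j‖ := by
    intro j
    have : (j : ℝ) + 1 ≠ 0 := by positivity
    rw [norm_mul, norm_mul, norm_pow]
    field_simp
  simp only [e3] at h
  exact ⟨h.1, (norm_tsum_le_tsum_norm h.1).trans h.2⟩

lemma hasSum_perturbed {b : ℕ → ℂ}
    (hb : ∀ r : ℝ, Summable (fun j : ℕ => ((j : ℝ) + 1) ^ 2 * (‖b j‖ ^ 2 * r ^ (2 * j)))) (z : ℂ) :
    HasSum (fun j => x j * b j * z ^ j) (∑' j, x j * b j * z ^ j) :=
  (summable_norm_perturbed hx hb z).1.of_norm.hasSum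

lemma norm_perturbed_le (hc : ∀ z : ℂ, HasSum (fun j => c j * z ^ j) (f z)) {r δ : ℝ}
    (hr : 0 < r) (hδ : 0 < δ) (hδ1 : δ ≤ 1) {z : ℂ} (hz : ‖z‖ ≤ r) :
    ‖∑' j, x j * c j * z ^ j‖ ≤ Real.sqrt (∑' j : ℕ, ‖x j‖ ^ 2 / ((j : ℝ) + 1) ^ 2) *
      (4 * maxModulus f (r * (1 + δ)) * δ ^ (-(3 / 2) : ℝ)) := by
  refine (summable_norm_perturbed hx (summable_sq_mul_coeff hc) z).2.trans ?_
  refine mul_le_mul_of_nonneg_left ?_ (Real.sqrt_nonneg _)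
  refine le_trans (Real.sqrt_le_sqrt ?_) (sqrt_tsum_sq_mul_coeff_le hc hr hδ hδ1)
  refine (summable_sq_mul_coeff hc ‖z‖).tsum_le_tsum (fun j => ?_) (summable_sq_mul_coeff hc r)
  gcongr

/-- `z g'(z)` is obtained by termwise differentiation. -/
lemma tsum_starCoeff_eq (hc : ∀ z : ℂ, HasSum (fun j => c j * z ^ j) (f z)) (z : ℂ) :
    ∑' j, x j * starCoeff c j * z ^ j = z * deriv (fun z => ∑' j, x j * c j * z ^ j) z := by
  have hs := (summable_norm_perturbed hx (summable_sq_mul_coeff hc) ((‖z‖ + 1 : ℝ) : ℂ)).1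
  have h := Complex.hasSum_deriv_of_summable_norm (F := fun j z => x j * c j * z ^ j)
    (U := Metric.ball 0 (‖z‖ + 1)) hs (fun j => by fun_prop) Metric.isOpen_ball
    (fun j w hw => by
      rw [norm_mul, norm_mul _ (_ ^ j), norm_pow, norm_pow, Complex.norm_real,
        Real.norm_of_nonneg (by positivity)]
      gcongr
      exact (mem_ball_zero_iff.1 hw).le) (z := z) (by simp)
  rw [← h.tsum_eq, ← tsum_mul_left]
  refine tsum_congr fun j => ?_
  have e : deriv (fun z : ℂ => x j * c j * z ^ j) z = x j * c j * (j * z ^ (j - 1)) := by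
    rw [deriv_const_mul _ (by fun_prop), deriv_pow_field]
  rw [e, starCoeff]
  rcases j with _ | j
  · simp
  · simp only [Nat.add_sub_cancel, pow_succ]
    ring

end Perturbed

end PowerSeries

/-! ### Almost sure properties of the random coefficients. -/

section Probability

variable {Ω : Type*} [MeasurableSpace Ω] {μ : Measure Ω} {χ : ℕ → Ω → ℂ}

/-- Square-integrable variables with unit second moments satisfy `∑ |χ_j|² / (j + 1)² < ∞` almost
surely. -/
lemma ae_summable_norm_sq_div (hmeas : ∀ j, Measurable (χ j)) (hL2 : ∀ j, MemLp (χ j) 2 μ)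
    (hone : ∀ j, ∫ ω, ‖χ j ω‖ ^ 2 ∂μ = 1) :
    ∀ᵐ ω ∂μ, Summable fun j : ℕ => ‖χ j ω‖ ^ 2 / ((j : ℝ) + 1) ^ 2 := by
  have hterm : ∀ j : ℕ, ∫⁻ ω, ENNReal.ofReal (‖χ j ω‖ ^ 2 / ((j : ℝ) + 1) ^ 2) ∂μ =
      ENNReal.ofReal (1 / ((j : ℝ) + 1) ^ 2) := by
    intro j
    rw [← ofReal_integral_eq_lintegral_ofReal (((hL2 j).integrable_norm_pow two_ne_zero).div_const _)
      (ae_of_all _ fun ω => by positivity), integral_div, hone]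
  have hs : Summable fun j : ℕ => 1 / ((j : ℝ) + 1) ^ 2 := by
    have := (summable_nat_add_iff 1).2 (Real.summable_one_div_nat_pow.2 one_lt_two)
    exact_mod_cast this
  have hfin : ∫⁻ ω, ∑' j : ℕ, ENNReal.ofReal (‖χ j ω‖ ^ 2 / ((j : ℝ) + 1) ^ 2) ∂μ ≠ ∞ := by
    rw [lintegral_tsum fun j => by have := hmeas j; fun_prop]
    simp_rw [hterm]
    exact hs.tsum_ofReal_ne_top
  have hm : Measurable fun ω => ∑' j : ℕ, ENNReal.ofReal (‖χ j ω‖ ^ 2 / ((j : ℝ) + 1) ^ 2) :=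
    Measurable.tsum fun j => by have := hmeas j; fun_prop
  filter_upwards [ae_lt_top hm hfin] with ω hω
  have := ENNReal.summable_toReal hω.ne
  refine this.congr fun j => ?_
  rw [ENNReal.toReal_ofReal (by positivity)]

/-- Needed for Markov's inequality. On the product of `Ω` with the circle the series is an almost
everywhere limit of measurable partial sums, and integrating out the angle preserves a.e.
measurability. -/
lemma aemeasurable_logDeviation [SFinite μ] (hmeas : ∀ j, Measurable (χ j))
    (hsum : ∀ᵐ ω ∂μ, Summable fun j : ℕ => ‖χ j ω‖ ^ 2 / ((j : ℝ) + 1) ^ 2) {b : ℕ → ℂ}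
    (hb : ∀ r : ℝ, Summable (fun j : ℕ => ((j : ℝ) + 1) ^ 2 * (‖b j‖ ^ 2 * r ^ (2 * j)))) (r : ℝ) :
    AEMeasurable (logDeviation χ b r) μ := by
  set ν : Measure ℝ := volume.restrict (Set.Ioc 0 (2 * Real.pi)) with hν
  have hpart : ∀ N : ℕ, Measurable fun p : Ω × ℝ =>
      ∑ j ∈ Finset.range N, χ j p.1 * b j * circleMap 0 r p.2 ^ j := by
    intro N
    have hcm := (continuous_circleMap 0 r).measurable
    refine Finset.measurable_sum _ fun j _ => ?_
    have := hmeas j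
    fun_prop
  have hF : AEMeasurable (fun p : Ω × ℝ => randomSeries χ b p.1 (circleMap 0 r p.2)) (μ.prod ν) := by
    refine aemeasurable_of_tendsto_metrizable_ae atTop (fun N => (hpart N).aemeasurable) ?_
    filter_upwards [Measure.quasiMeasurePreserving_fst.ae hsum] with p hp
    exact (hasSum_perturbed hp hb (circleMap 0 r p.2)).tendsto_sum_nat
  have hG : AEMeasurable (fun p : Ω × ℝ =>
      |Real.log (‖randomSeries χ b p.1 (circleMap 0 r p.2)‖ / sigma b r)|) (μ.prod ν) :=
    (Real.measurable_log.comp_aemeasurable (hF.norm.div_const _)).abs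
  have h := hG.aestronglyMeasurable.integral_prod_right'
  have e : logDeviation χ b r = fun ω => (2 * Real.pi)⁻¹ *
      ∫ θ, |Real.log (‖randomSeries χ b ω (circleMap 0 r θ)‖ / sigma b r)| ∂ν := by
    funext ω
    rw [logDeviation, Real.circleAverage_def, smul_eq_mul,
      intervalIntegral.integral_of_le (by positivity)]
  rw [e]
  exact h.aemeasurable.const_mul _

/-- Under Condition Y, the deviations along a sequence of radii tending to infinity are almost
surely eventually at most `((C / A) log n) ^ (1 / B)`. -/
lemma ConditionY.ae_eventually_le {b : ℕ → ℂ} {A B C : ℝ} (hY : ConditionY μ χ b A B)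
    (hm : ∀ r, AEMeasurable (logDeviation χ b r) μ) (hC : 1 < C) {ρ : ℕ → ℝ}
    (hρ : Tendsto ρ atTop atTop) :
    ∀ᵐ ω ∂μ, ∀ᶠ n : ℕ in atTop,
      |logDeviation χ b (ρ n) ω| ≤ (C / A * Real.log n) ^ (1 / B) := by
  obtain ⟨hA, hB, -, K, hK⟩ := hY
  have hK' := hρ.eventually hK
  obtain ⟨N, hN⟩ := eventually_atTop.1 hK'
  -- On `s n` the exponential moment's integrand is at least `n ^ C`, so Markov gives `μ (s n) ≤ K n
  -- ^ (-C)`, summable because `C > 1`. Below `N + 1` the event is made empty.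
  set s : ℕ → Set Ω := fun n => {ω | N + 1 ≤ n ∧
    (C / A * Real.log n) ^ (1 / B) < |logDeviation χ b (ρ n) ω|} with hs
  have hle : ∀ n, μ (s n) ≤ K * ENNReal.ofReal ((n : ℝ) ^ (-C)) := by
    intro n
    by_cases hn : N + 1 ≤ n
    · have hn0 : (1 : ℝ) ≤ n := by exact_mod_cast (Nat.succ_le_succ (Nat.zero_le N)).trans hn
      have hnpos : (0 : ℝ) < n := by linarith
      have hlog : 0 ≤ Real.log n := Real.log_nonneg hn0
      set g : Ω → ℝ≥0∞ := fun ω =>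
        ENNReal.ofReal (Real.exp (A * |logDeviation χ b (ρ n) ω| ^ B)) with hg
      have hgm : AEMeasurable g μ := by
        have := (hm (ρ n)).abs
        fun_prop
      have hsub : s n ⊆ {ω | ENNReal.ofReal ((n : ℝ) ^ C) ≤ g ω} := by
        rintro ω ⟨-, hω⟩
        refine ENNReal.ofReal_le_ofReal ?_
        rw [Real.rpow_def_of_pos hnpos]
        refine Real.exp_le_exp.2 ?_
        have h0 : 0 ≤ C / A * Real.log n := by positivity
        have h1 := Real.rpow_le_rpow (by positivity) hω.le hB.le
        rw [← Real.rpow_mul h0, one_div, inv_mul_cancel₀ hB.ne', Real.rpow_one] at h1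
        calc Real.log n * C = A * (C / A * Real.log n) := by field_simp
          _ ≤ _ := by gcongr
      have hmk := mul_meas_ge_le_lintegral₀ hgm (ENNReal.ofReal ((n : ℝ) ^ C))
      have h2 : ENNReal.ofReal ((n : ℝ) ^ C) * μ (s n) ≤ K :=
        (mul_le_mul_right (measure_mono hsub) _).trans (hmk.trans (hN n (by omega)))
      have hpos : 0 < (n : ℝ) ^ C := Real.rpow_pos_of_pos hnpos _
      rw [Real.rpow_neg hnpos.le, ENNReal.ofReal_inv_of_pos hpos, ← div_eq_mul_inv,
        ENNReal.le_div_iff_mul_le (Or.inl (by simpa using hpos)) (Or.inl ENNReal.ofReal_ne_top),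
        mul_comm]
      exact h2
    · have : s n = ∅ := Set.eq_empty_of_forall_notMem fun ω hω => hn hω.1
      simp [this]
  have hsum : ∑' n, μ (s n) ≠ ∞ := by
    refine ne_top_of_le_ne_top ?_ (ENNReal.tsum_le_tsum hle)
    rw [ENNReal.tsum_mul_left]
    exact ENNReal.mul_ne_top ENNReal.coe_ne_top
      (Real.summable_nat_rpow.2 (by linarith)).tsum_ofReal_ne_top
  filter_upwards [ae_eventually_notMem hsum] with ω hω
  filter_upwards [hω, eventually_ge_atTop (N + 1)] with n hn hnN
  by_contra hlt
  exact hn ⟨hnN, not_le.1 hlt⟩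

/-- Independent, identically distributed variables that are not almost surely zero do not all vanish
on an infinite set of indices. -/
lemma ae_exists_ne_zero [IsProbabilityMeasure μ] (hmeas : ∀ j, Measurable (χ j))
    (hindep : iIndepFun χ μ) (hident : ∀ i j, IdentDistrib (χ i) (χ j) μ μ)
    (hone : ∀ j, ∫ ω, ‖χ j ω‖ ^ 2 ∂μ = 1) {S : Set ℕ} (hS : S.Infinite) :
    ∀ᵐ ω ∂μ, ∃ j ∈ S, χ j ω ≠ 0 := by
  set q := μ (χ 0 ⁻¹' {0}) with hq
  have hqj : ∀ j, μ (χ j ⁻¹' {0}) = q := fun j =>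
    (hident j 0).measure_mem_eq (measurableSet_singleton 0)
  have hq1 : q < 1 := by
    refine lt_of_le_of_ne prob_le_one fun h => ?_
    have hae : ∀ᵐ ω ∂μ, χ 0 ω = 0 :=
      (prob_compl_eq_zero_iff (hmeas 0 (measurableSet_singleton 0))).2 h
    have h0 : ∫ ω, ‖χ 0 ω‖ ^ 2 ∂μ = 0 := by
      rw [integral_eq_zero_of_ae]
      filter_upwards [hae] with ω hω
      simp [hω]
    rw [hone 0] at h0
    exact one_ne_zero h0
  have hle : ∀ n : ℕ, μ {ω | ¬ ∃ j ∈ S, χ j ω ≠ 0} ≤ q ^ n := by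
    intro n
    obtain ⟨t, htS, htn⟩ := hS.exists_subset_card_eq n
    have h1 := hindep.measure_inter_preimage_eq_mul t (sets := fun _ => {0})
      (fun _ _ => measurableSet_singleton 0)
    simp only [hqj, Finset.prod_const, htn] at h1
    rw [← h1]
    refine measure_mono fun ω hω => ?_
    simp only [Set.mem_iInter, Set.mem_preimage, Set.mem_singleton_iff]
    intro j hj
    by_contra hne
    exact hω ⟨j, htS hj, hne⟩
  have ht : Tendsto (fun n : ℕ => q ^ n) atTop (𝓝 0) :=
    ENNReal.tendsto_pow_atTop_nhds_zero_of_lt_one hq1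
  exact nonpos_iff_eq_zero.1 (ge_of_tendsto' ht hle)

end Probability

lemma eventually_log_one_add_le {ε : ℝ} (hε : 0 < ε) :
    ∀ᶠ t : ℝ in atTop, Real.log (1 + t) ≤ ε * t := by
  have h := (Real.isLittleO_log_id_atTop.def (half_pos hε))
  have h2 : ∀ᶠ t : ℝ in atTop, Real.log 2 ≤ ε / 2 * t :=
    (tendsto_id.const_mul_atTop (half_pos hε)).eventually_ge_atTop _
  filter_upwards [h, h2, eventually_ge_atTop 1] with t h1 h2 h3
  simp only [id, Real.norm_eq_abs] at h1
  rw [abs_of_nonneg (Real.log_nonneg h3), abs_of_nonneg (by linarith)] at h1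
  have : Real.log (1 + t) ≤ Real.log (2 * t) := Real.log_le_log (by linarith) (by linarith)
  rw [Real.log_mul two_ne_zero (by linarith)] at this
  linarith

/-! ### Jensen's formula and its consequences. -/

section Entire

variable {g : ℂ → ℂ}

lemma divisor_nonneg_of_differentiable (hg : Differentiable ℂ g) :
    0 ≤ MeromorphicOn.divisor g Set.univ :=
  MeromorphicOn.AnalyticOnNhd.divisor_nonneg fun z _ => hg.analyticAt z

/-- Jensen's formula for the `a`-points of an entire function. -/
lemma countingN_eq_circleAverage_sub (hg : Differentiable ℂ g) (a : ℂ) {r : ℝ} (hr : 0 < r) :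
    countingN r a g = Real.circleAverage (fun z => Real.log ‖g z - a‖) 0 r -
      Real.log ‖meromorphicTrailingCoeffAt (fun z => g z - a) 0‖ := by
  have hd : Differentiable ℂ (fun z => g z - a) := hg.sub_const a
  rw [countingN, ValueDistribution.logCounting_coe,
    posPart_eq_self.2 (divisor_nonneg_of_differentiable hd),
    Function.locallyFinsuppWithin.logCounting_divisor_eq_circleAverage_sub_const
      (fun z => (hd.analyticAt z).meromorphicAt) hr.ne']

/-- By Jensen's formula the mean is a counting function plus a constant, and without poles the
counting function increases. This carries lower bounds from discrete radii to all larger ones. -/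
lemma circleAverage_log_norm_monotoneOn (hg : Differentiable ℂ g) :
    MonotoneOn (Real.circleAverage (fun z => Real.log ‖g z‖) 0) (Set.Ioi 0) := by
  intro r hr s hs hrs
  have h := Function.locallyFinsuppWithin.logCounting_mono (divisor_nonneg_of_differentiable hg)
    hr hs hrs
  have hm : Meromorphic g := fun z => (hg.analyticAt z).meromorphicAt
  rw [Function.locallyFinsuppWithin.logCounting_divisor_eq_circleAverage_sub_const hm
      (ne_of_gt hr),
    Function.locallyFinsuppWithin.logCounting_divisor_eq_circleAverage_sub_const hm
      (ne_of_gt hs)] at h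
  linarith

/-- The logarithmic derivative estimate is normalised by a nonzero value at `0`; a zero of `f_ω - a`
there is split off first. -/
lemma exists_eq_pow_mul (hg : Differentiable ℂ g) {z₀ : ℂ} (h0 : g z₀ ≠ 0) :
    ∃ (k : ℕ) (h : ℂ → ℂ), Differentiable ℂ h ∧ h 0 ≠ 0 ∧ ∀ z, g z = z ^ k * h z := by
  obtain ⟨p, hp⟩ := hg.analyticAt 0
  have hA : AnalyticOnNhd ℂ g Set.univ := fun z _ => hg.analyticAt z
  have hp0 : p ≠ 0 := by
    intro h
    exact h0 (hA.eqOn_zero_of_preconnected_of_eventuallyEq_zero isPreconnected_univ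
      (Set.mem_univ 0) (hp.locally_zero_iff.2 h) (Set.mem_univ z₀))
  have hd : ∀ k, Differentiable ℂ ((Function.swap dslope 0)^[k] g) := by
    intro k
    induction k with
    | zero => exact hg
    | succ k ih =>
      rw [Function.iterate_succ_apply']
      exact differentiableOn_univ.1
        ((Complex.differentiableOn_dslope Filter.univ_mem).2 ih.differentiableOn)
  refine ⟨p.order, _, hd p.order, hp.iterate_dslope_fslope_ne_zero hp0, ?_⟩
  intro z
  simpa using hp.eq_pow_order_mul_iterate_dslope z

/-- The mean of `|log (|g| / s)|` controls the difference of the mean of `log |g|` and `log s`. -/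
lemma log_sub_le_circleAverage (hg : Differentiable ℂ g) {z₀ : ℂ} (h0 : g z₀ ≠ 0) {r s : ℝ}
    (hr : 0 < r) (hs : 0 < s) :
    Real.log s - Real.circleAverage (fun z => |Real.log (‖g z‖ / s)|) 0 r ≤
      Real.circleAverage (fun z => Real.log ‖g z‖) 0 r := by
  have hi : CircleIntegrable (fun z => Real.log ‖g z‖) 0 r :=
    MeromorphicOn.circleIntegrable_log_norm fun z _ => (hg.analyticAt z).meromorphicAt
  have hi2 : CircleIntegrable (fun z => |Real.log (‖g z‖ / s)|) 0 r := by
    have : CircleIntegrable (fun z => Real.log ‖g z / s‖) 0 r :=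
      MeromorphicOn.circleIntegrable_log_norm fun z _ =>
        ((hg.div_const (s : ℂ)).analyticAt z).meromorphicAt
    have e : (fun z => |Real.log (‖g z‖ / s)|) = |fun z => Real.log ‖g z / s‖| := by
      funext z
      rw [Pi.abs_apply, norm_div, Complex.norm_real, Real.norm_of_nonneg hs.le]
    rw [e]
    exact this.abs
  have h := circleAverage_mono_of_countable hr.ne' ((circleIntegrable_const (Real.log s) 0 r).sub hi2)
    hi (countable_zeros hg h0) (fun z _ hz => by
      have hz' : 0 < ‖g z‖ := norm_pos_iff.2 hz
      simp only [Pi.sub_apply]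
      rw [Real.log_div hz'.ne' hs.ne']
      have := neg_abs_le (Real.log ‖g z‖ - Real.log s)
      linarith)
  rw [Real.circleAverage_sub (circleIntegrable_const _ _ _) hi2, Real.circleAverage_const] at h
  exact h

end Entire

/-! ### Estimates for one fixed sample of the coefficients. -/

section Perturbed

variable {f : ℂ → ℂ} {c : ℕ → ℂ} {x : ℕ → ℂ}

lemma maxModulus_pos (hc : ∀ z : ℂ, HasSum (fun j => c j * z ^ j) (f z)) {j : ℕ}
    (hcj : c j ≠ 0) {r : ℝ} (hr : 0 < r) : 0 < maxModulus f r := by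
  refine lt_of_lt_of_le ?_ (norm_coeff_mul_pow_le hc hr
    (fun z hz => norm_le_maxModulus (differentiable_of_hasSum hc).continuous hz) j)
  have := norm_pos_iff.2 hcj
  positivity

lemma norm_perturbed_sub_le (hc : ∀ z : ℂ, HasSum (fun j => c j * z ^ j) (f z))
    (hx : Summable fun j : ℕ => ‖x j‖ ^ 2 / ((j : ℝ) + 1) ^ 2) (a : ℂ) :
    ∃ K : ℝ, 1 ≤ K ∧ ∀ r δ : ℝ, 0 < r → 0 < δ → δ ≤ 1 → 1 ≤ maxModulus f (r * (1 + δ)) →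
      ∀ z : ℂ, ‖z‖ ≤ r → ‖∑' j, x j * c j * z ^ j - a‖ ≤
        K * maxModulus f (r * (1 + δ)) * δ ^ (-(3 / 2) : ℝ) := by
  set U := Real.sqrt (∑' j : ℕ, ‖x j‖ ^ 2 / ((j : ℝ) + 1) ^ 2) with hU
  have hU0 : 0 ≤ U := Real.sqrt_nonneg _
  refine ⟨4 * U + ‖a‖ + 1, by linarith [norm_nonneg a], fun r δ hr hδ hδ1 hM z hz => ?_⟩
  have h1 := norm_perturbed_le hx hc hr hδ hδ1 hz
  have h2 : 1 ≤ δ ^ (-(3 / 2) : ℝ) := Real.one_le_rpow_of_pos_of_le_one_of_nonpos hδ hδ1 (by norm_num)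
  have h3 : 1 ≤ maxModulus f (r * (1 + δ)) * δ ^ (-(3 / 2) : ℝ) := one_le_mul_of_one_le_of_one_le hM h2
  refine (norm_sub_le _ _).trans ?_
  have h4 : ‖a‖ ≤ ‖a‖ * (maxModulus f (r * (1 + δ)) * δ ^ (-(3 / 2) : ℝ)) :=
    le_mul_of_one_le_right (norm_nonneg a) h3
  nlinarith

lemma differentiable_perturbed (hc : ∀ z : ℂ, HasSum (fun j => c j * z ^ j) (f z))
    (hx : Summable fun j : ℕ => ‖x j‖ ^ 2 / ((j : ℝ) + 1) ^ 2) :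
    Differentiable ℂ (fun z => ∑' j, x j * c j * z ^ j) :=
  differentiable_of_hasSum fun z => hasSum_perturbed hx (summable_sq_mul_coeff hc) z

lemma exists_starSeries_ne_zero (hc : ∀ z : ℂ, HasSum (fun j => c j * z ^ j) (f z))
    (hx : Summable fun j : ℕ => ‖x j‖ ^ 2 / ((j : ℝ) + 1) ^ 2) {j : ℕ} (hj : j ≠ 0)
    (hcj : c j ≠ 0) (hxj : x j ≠ 0) : ∃ z, ∑' j, x j * starCoeff c j * z ^ j ≠ 0 := by
  by_contra hcon
  push Not at hcon
  have h := norm_coeff_mul_pow_le (c := fun j => x j * starCoeff c j) (f := fun _ => 0) (M := 0)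
    (r := 1) (fun z => by
      have := hasSum_perturbed hx (summable_sq_mul_starCoeff hc) z
      rwa [hcon z] at this) one_pos (fun z _ => by simp) j
  rw [one_pow, mul_one] at h
  have h0 : x j * starCoeff c j = 0 := norm_le_zero_iff.1 h
  have : (j : ℂ) ≠ 0 := Nat.cast_ne_zero.2 hj
  simp [starCoeff, hxj, hcj, this] at h0

/-- Upper bound for the counting function of a perturbed power series. -/
lemma eventually_countingN_le (hc : ∀ z : ℂ, HasSum (fun j => c j * z ^ j) (f z))
    (htop : Tendsto (maxModulus f) atTop atTop)
    (hx : Summable fun j : ℕ => ‖x j‖ ^ 2 / ((j : ℝ) + 1) ^ 2) (a : ℂ) :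
    ∀ᶠ r in atTop,
      maxModulus f (r * (1 + (1 + Real.log (maxModulus f r)) ^ (-(5 / 4) : ℝ))) ≤
        Real.exp 1 * maxModulus f r →
      countingN r a (fun z => ∑' j, x j * c j * z ^ j) ≤ Real.log (maxModulus f r) +
        2 * Real.log (Real.log (maxModulus f r)) := by
  obtain ⟨K, hK1, hK⟩ := norm_perturbed_sub_le hc hx a
  set g : ℂ → ℂ := fun z => ∑' j, x j * c j * z ^ j with hg
  have hgd : Differentiable ℂ g := differentiable_perturbed hc hx
  set κ := Real.log ‖meromorphicTrailingCoeffAt (fun z => g z - a) 0‖ with hκ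
  have hlog := Real.tendsto_log_atTop.comp htop
  have hloglog := Real.tendsto_log_atTop.comp hlog
  -- With `δ = (1 + L) ^ (-5/4)` the factor `δ ^ (-3/2)` is `(1 + L) ^ (15/8)`. The remaining `(1/8)
  -- log L` absorbs the constants, hence the factor `8` in the last threshold.
  filter_upwards [eventually_gt_atTop 0, htop.eventually_ge_atTop 1, hlog.eventually_ge_atTop 1,
    hloglog.eventually_ge_atTop (8 * (Real.log K + 1 - κ + 15 / 8 * Real.log 2))]
    with r hr hM hL hLL hgrow
  simp only [Function.comp_apply] at hL hLL
  set M := maxModulus f r with hMdef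
  set L := Real.log M with hLdef
  set δ := (1 + L) ^ (-(5 / 4) : ℝ) with hδdef
  have h1L : 1 ≤ 1 + L := by linarith
  have hδ : 0 < δ := Real.rpow_pos_of_pos (by linarith) _
  have hδ1 : δ ≤ 1 := Real.rpow_le_one_of_one_le_of_nonpos h1L (by norm_num)
  have hrδ : r ≤ r * (1 + δ) := by nlinarith
  have hM' : 1 ≤ maxModulus f (r * (1 + δ)) := by
    refine hM.trans (maxModulus_monotoneOn (differentiable_of_hasSum hc) hr ?_ hrδ)
    exact hr.trans_le hrδ
  have hδ' : δ ^ (-(3 / 2) : ℝ) = (1 + L) ^ (15 / 8 : ℝ) := by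
    rw [hδdef, ← Real.rpow_mul (by linarith)]; norm_num
  have hMpos : 0 < M := by linarith
  have hpow : 1 ≤ (1 + L) ^ (15 / 8 : ℝ) := Real.one_le_rpow h1L (by norm_num)
  have hbd : ∀ z, ‖z‖ = r → ‖g z - a‖ ≤ K * (Real.exp 1 * M) * (1 + L) ^ (15 / 8 : ℝ) := by
    intro z hz
    refine (hK r δ hr hδ hδ1 hM' z hz.le).trans ?_
    rw [hδ']
    gcongr
  have hbig : 1 ≤ K * (Real.exp 1 * M) * (1 + L) ^ (15 / 8 : ℝ) := by
    have h2 : (1 : ℝ) ≤ Real.exp 1 := Real.one_le_exp zero_le_one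
    exact one_le_mul_of_one_le_of_one_le
      (one_le_mul_of_one_le_of_one_le hK1 (one_le_mul_of_one_le_of_one_le h2 hM)) hpow
  have hJ : Real.circleAverage (fun z => Real.log ‖g z - a‖) 0 r ≤
      Real.log (K * (Real.exp 1 * M) * (1 + L) ^ (15 / 8 : ℝ)) := by
    refine Real.circleAverage_mono_on_of_le_circle ?_ fun z hz => ?_
    · exact MeromorphicOn.circleIntegrable_log_norm fun z _ =>
        ((hgd.sub_const a).analyticAt z).meromorphicAt
    · rw [mem_sphere_zero_iff_norm, abs_of_pos hr] at hz
      rcases (norm_nonneg (g z - a)).eq_or_lt' with h0 | h0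
      · rw [h0, Real.log_zero]; exact Real.log_nonneg hbig
      · exact Real.log_le_log h0 (hbd z hz)
  rw [Real.log_mul (by positivity) (by positivity), Real.log_mul (by positivity) (by positivity),
    Real.log_mul (by positivity) (by positivity), Real.log_exp, Real.log_rpow (by linarith)] at hJ
  have h3 : Real.log (1 + L) ≤ Real.log 2 + Real.log L := by
    rw [← Real.log_mul two_ne_zero (by linarith)]
    exact Real.log_le_log (by linarith) (by linarith)
  rw [countingN_eq_circleAverage_sub hgd a hr]
  linarith

/-- The mean of `log |z g'|` exceeds that of `log |g - a|` by at most `(3 / 2) log log M(r, f)` for a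
perturbed power series `g`, if `log M(r, f)` grows moderately at `r`. -/
lemma eventually_circleAverage_star_le (hc : ∀ z : ℂ, HasSum (fun j => c j * z ^ j) (f z))
    (htop : Tendsto (maxModulus f) atTop atTop)
    (hx : Summable fun j : ℕ => ‖x j‖ ^ 2 / ((j : ℝ) + 1) ^ 2) {j : ℕ} (hj : j ≠ 0)
    (hcj : c j ≠ 0) (hxj : x j ≠ 0) (a : ℂ) :
    ∀ᶠ r in atTop,
      Real.log (maxModulus f (r * (1 + (1 + Real.log (Real.log (maxModulus f r))) ^
        (-(5 / 4) : ℝ)))) ≤ Real.exp 1 * Real.log (maxModulus f r) →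
      Real.circleAverage (fun z => Real.log ‖∑' j, x j * starCoeff c j * z ^ j‖) 0 r ≤
        Real.circleAverage (fun z => Real.log ‖∑' j, x j * c j * z ^ j - a‖) 0 r +
          3 / 2 * Real.log (Real.log (maxModulus f r)) := by
  obtain ⟨K, hK1, hK⟩ := norm_perturbed_sub_le hc hx a
  obtain ⟨K', hK'1, hLD⟩ := exists_circleAverage_log_deriv_le
  obtain ⟨z₁, hz₁⟩ := exists_starSeries_ne_zero hc hx hj hcj hxj
  set g : ℂ → ℂ := fun z => ∑' j, x j * c j * z ^ j with hg
  have hgd : Differentiable ℂ g := differentiable_perturbed hc hx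
  have hstar : ∀ z, ∑' j, x j * starCoeff c j * z ^ j = z * deriv (fun z => g z - a) z := by
    intro z
    rw [tsum_starCoeff_eq hx hc z, deriv_sub_const]
  rw [hstar] at hz₁
  have hnc : ∃ z, deriv (fun z => g z - a) z ≠ 0 := ⟨z₁, right_ne_zero_of_mul hz₁⟩
  obtain ⟨z₀, hz₀⟩ : ∃ z, g z - a ≠ 0 := by
    by_contra hcon
    push Not at hcon
    obtain ⟨z, hz⟩ := hnc
    apply hz
    have : (fun z => g z - a) = fun _ => 0 := funext hcon
    rw [this]; simp
  obtain ⟨k, G₁, hG₁, hG₁0, hG⟩ := exists_eq_pow_mul (g := fun z => g z - a) (hgd.sub_const a) hz₀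
  have hG₁0' : 0 < ‖G₁ 0‖ := norm_pos_iff.2 hG₁0
  have hlog := Real.tendsto_log_atTop.comp htop
  have hloglog := Real.tendsto_log_atTop.comp hlog
  have hexp : Real.exp 1 < 3 := Real.exp_one_lt_three
  -- Thresholds for two absorptions. In the exponent, `e L + (15/8)(L / 8) + L / 2 ≤ 4 L`. In the
  -- conclusion, constants and `(5/2) log (1 + log L)` take `1/16` of `log L` each, and `(4/3)(1 +
  -- 1/16 + 1/16) = 3/2`.
  filter_upwards [eventually_ge_atTop 1, htop.eventually_ge_atTop 1, hlog.eventually_ge_atTop 1,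
    hloglog.eventually_ge_atTop 0,
    hlog.eventually_ge_atTop (2 * (Real.log K + 3 / 2 * Real.log 5 - Real.log ‖G₁ 0‖)),
    hlog.eventually (eventually_log_one_add_le (ε := 1 / 8) (by norm_num)),
    hloglog.eventually_ge_atTop (16 * (Real.log K' + Real.log (k + 1) + Real.log 100)),
    hloglog.eventually (eventually_log_one_add_le (ε := 1 / 40) (by norm_num))]
    with r hr hM hL hLL hL2 hL3 hLL2 hLL3 hgrow
  simp only [Function.comp_apply] at hL hLL hL2 hL3 hLL2 hLL3
  set M := maxModulus f r with hMdef
  set L := Real.log M with hLdef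
  set δ₀ := (1 + Real.log L) ^ (-(5 / 4) : ℝ) with hδ₀def
  have hr0 : 0 < r := by linarith
  have h1L : 1 ≤ 1 + Real.log L := by linarith
  have hδ₀ : 0 < δ₀ := Real.rpow_pos_of_pos (by linarith) _
  have hδ₀1 : δ₀ ≤ 1 := Real.rpow_le_one_of_one_le_of_nonpos h1L (by norm_num)
  -- The factor `1 + 2 δ` is for the logarithmic derivative and `1 + δ` for bounding the series by
  -- `M`; their product is at most `1 + 5 δ = 1 + δ₀`.
  set δ := δ₀ / 5 with hδdef
  have hδ : 0 < δ := by positivity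
  have hδ1 : δ ≤ 1 := by rw [hδdef]; linarith
  have hmono := maxModulus_monotoneOn (differentiable_of_hasSum hc)
  have hlogδ₀ : Real.log δ₀ = -(5 / 4) * Real.log (1 + Real.log L) := by
    rw [hδ₀def, Real.log_rpow (by linarith)]
  have hlogδ : Real.log δ = -(5 / 4) * Real.log (1 + Real.log L) - Real.log 5 := by
    rw [hδdef, Real.log_div hδ₀.ne' (by norm_num), hlogδ₀]
  have hr1 : r * (1 + 2 * δ) * (1 + δ) ≤ r * (1 + δ₀) := by
    rw [mul_assoc]
    gcongr
    have : δ₀ = 5 * δ := by rw [hδdef]; ring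
    rw [this]; nlinarith
  have hr2 : r ≤ r * (1 + 2 * δ) * (1 + δ) := by
    rw [mul_assoc]
    exact le_mul_of_one_le_right hr0.le
      (one_le_mul_of_one_le_of_one_le (by linarith) (by linarith))
  have hM1 : 1 ≤ maxModulus f (r * (1 + 2 * δ) * (1 + δ)) :=
    hM.trans (hmono hr0 (hr0.trans_le hr2) hr2)
  have hMle : maxModulus f (r * (1 + 2 * δ) * (1 + δ)) ≤ Real.exp (Real.exp 1 * L) := by
    have h1 := hmono (hr0.trans_le hr2) ((hr0.trans_le hr2).trans_le hr1) hr1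
    refine h1.trans ?_
    rw [← Real.log_le_iff_le_exp (by linarith)]
    exact hgrow
  have hloglogL : Real.log (1 + Real.log L) ≤ Real.log (1 + L) := by
    refine Real.log_le_log (by linarith) ?_
    have := Real.log_le_sub_one_of_pos (by linarith : 0 < L)
    linarith
  have hA : ∀ z, ‖z‖ = r * (1 + 2 * δ) → ‖G₁ z‖ ≤ Real.exp (4 * L) * ‖G₁ 0‖ := by
    intro z hz
    have hz1 : 1 ≤ ‖z‖ := by rw [hz]; nlinarith
    have h1 : ‖G₁ z‖ ≤ ‖g z - a‖ := by
      rw [hG z, norm_mul, norm_pow]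
      exact le_mul_of_one_le_left (norm_nonneg _) (one_le_pow₀ hz1)
    have h2 := hK (r * (1 + 2 * δ)) δ (by positivity) hδ hδ1 hM1 z hz.le
    have h3 : K * maxModulus f (r * (1 + 2 * δ) * (1 + δ)) * δ ^ (-(3 / 2) : ℝ) ≤
        Real.exp (4 * L) * ‖G₁ 0‖ := by
      have e1 : δ ^ (-(3 / 2) : ℝ) = Real.exp (-(3 / 2) * Real.log δ) := by
        rw [Real.rpow_def_of_pos hδ, mul_comm]
      have e2 : ‖G₁ 0‖ = Real.exp (Real.log ‖G₁ 0‖) := (Real.exp_log hG₁0').symm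
      have e3 : K = Real.exp (Real.log K) := (Real.exp_log (by linarith)).symm
      calc K * maxModulus f (r * (1 + 2 * δ) * (1 + δ)) * δ ^ (-(3 / 2) : ℝ)
          ≤ K * Real.exp (Real.exp 1 * L) * δ ^ (-(3 / 2) : ℝ) := by gcongr
        _ = Real.exp (Real.log K + Real.exp 1 * L + -(3 / 2) * Real.log δ) := by
            rw [Real.exp_add, Real.exp_add, ← e3, ← e1]
        _ ≤ Real.exp (4 * L + Real.log ‖G₁ 0‖) := by
            refine Real.exp_le_exp.2 ?_
            rw [hlogδ]
            nlinarith
        _ = Real.exp (4 * L) * ‖G₁ 0‖ := by rw [Real.exp_add, ← e2]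
    exact h1.trans (h2.trans h3)
  have hmain := hLD (fun z => g z - a) G₁ k hG₁ hG₁0 hG hnc r δ (4 * L) hr0 hδ hδ1 (by linarith) hA
  simp_rw [hstar]
  have hval : Real.log (K' * (k + 1) * (4 * L) / δ ^ 2) = Real.log K' + Real.log (k + 1) +
      Real.log 100 + Real.log L + 5 / 2 * Real.log (1 + Real.log L) := by
    have hk : (0 : ℝ) < k + 1 := by positivity
    rw [Real.log_div (by positivity) (by positivity), Real.log_mul (by positivity) (by positivity),
      Real.log_mul (by positivity) hk.ne', Real.log_mul (by norm_num) (by linarith), Real.log_pow,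
      hlogδ]
    have : Real.log 100 = Real.log 4 + 2 * Real.log 5 := by
      rw [show (100 : ℝ) = 4 * 5 ^ 2 by norm_num, Real.log_mul (by norm_num) (by norm_num),
        Real.log_pow]
      norm_num
    rw [this]
    push_cast
    ring
  rw [hval] at hmain
  linarith

/-- If the deviation of `log |z g'|` from `log σ*` is small along the radii `ρ n`, then `log M(r, f)`
is bounded in terms of the mean of `log |z g'|`. -/
lemma eventually_log_maxModulus_le (hc : ∀ z : ℂ, HasSum (fun j => c j * z ^ j) (f z))
    (hx : Summable fun j : ℕ => ‖x j‖ ^ 2 / ((j : ℝ) + 1) ^ 2) {j : ℕ} (hj : j ≠ 0)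
    (hcj : c j ≠ 0) (hxj : x j ≠ 0) {A B C C' : ℝ} (hA : 0 < A) (hB : 0 < B) (hC' : 0 < C')
    (hCC' : C' < C) {ρ : ℕ → ℝ} (hρ0 : ∀ n, 0 < ρ n)
    (hρ : ∀ᶠ n in atTop, sigma (starCoeff c) (ρ n) = Real.exp n)
    (hdev : ∀ᶠ n : ℕ in atTop,
      |Real.circleAverage (fun z => |Real.log (‖∑' j, x j * starCoeff c j * z ^ j‖ /
        sigma (starCoeff c) (ρ n))|) 0 (ρ n)| ≤ (C' / A * Real.log n) ^ (1 / B)) :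
    ∃ K : ℝ, ∀ᶠ r in atTop,
      Real.log (maxModulus f (r * (1 + (1 + Real.log (Real.log (maxModulus f r))) ^
        (-(5 / 4) : ℝ)))) ≤ Real.exp 1 * Real.log (maxModulus f r) →
      Real.log (maxModulus f r) ≤
        Real.circleAverage (fun z => Real.log ‖∑' j, x j * starCoeff c j * z ^ j‖) 0 r +
          (C / A * Real.log (Real.log (maxModulus f r))) ^ (1 / B) + K := by
  have htop := tendsto_maxModulus hc hj hcj
  obtain ⟨z₁, hz₁⟩ := exists_starSeries_ne_zero hc hx hj hcj hxj
  obtain ⟨K₀, hK₀, hMσ⟩ := exists_maxModulus_le_sigma hc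
  set g : ℂ → ℂ := fun z => ∑' j, x j * starCoeff c j * z ^ j with hg
  have hgd : Differentiable ℂ g :=
    differentiable_of_hasSum fun z => hasSum_perturbed hx (summable_sq_mul_starCoeff hc) z
  set σ := sigma (starCoeff c) with hσdef
  have hσs := summable_sigma_terms (summable_sq_mul_starCoeff hc)
  have hbj : starCoeff c j ≠ 0 := mul_ne_zero (Nat.cast_ne_zero.2 hj) hcj
  have hσtop : Tendsto σ atTop atTop := tendsto_sigma hσs hj hbj
  have hlogσ := Real.tendsto_log_atTop.comp hσtop
  obtain ⟨N, hN⟩ := eventually_atTop.1 (hρ.and hdev)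
  have hlog := Real.tendsto_log_atTop.comp htop
  have hloglog := Real.tendsto_log_atTop.comp hlog
  have hexp : Real.exp 1 < 3 := Real.exp_one_lt_three
  refine ⟨Real.log (‖c 0‖ + K₀) + 2, ?_⟩
  filter_upwards [eventually_ge_atTop 1, htop.eventually_ge_atTop 1, hlog.eventually_ge_atTop 1,
    hloglog.eventually_ge_atTop 0, hlog.eventually_ge_atTop (2 * Real.log 4),
    hlog.eventually (eventually_log_one_add_le (ε := 1 / 8) (by norm_num)),
    hlogσ.eventually_ge_atTop (N + 3), hσtop.eventually_ge_atTop 1,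
    (hloglog.const_mul_atTop (sub_pos.2 hCC')).eventually_ge_atTop (C' * Real.log 4)]
    with r hr hM hL hLL hL2 hL3 hσN hσ1 hLL2 hgrow
  simp only [Function.comp_apply] at hL hLL hL2 hL3 hσN hLL2
  set M := maxModulus f r with hMdef
  set L := Real.log M with hLdef
  set δ₀ := (1 + Real.log L) ^ (-(5 / 4) : ℝ) with hδ₀def
  have hr0 : 0 < r := by linarith
  have h1L : 1 ≤ 1 + Real.log L := by linarith
  have hδ₀ : 0 < δ₀ := Real.rpow_pos_of_pos (by linarith) _
  have hδ₀1 : δ₀ ≤ 1 := Real.rpow_le_one_of_one_le_of_nonpos h1L (by norm_num)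
  have hlogδ₀ : Real.log δ₀ = -(5 / 4) * Real.log (1 + Real.log L) := by
    rw [hδ₀def, Real.log_rpow (by linarith)]
  have hrδ : r ≤ r * (1 + δ₀) := by nlinarith
  have hM1 : 1 ≤ maxModulus f (r * (1 + δ₀)) :=
    hM.trans (maxModulus_monotoneOn (differentiable_of_hasSum hc) hr0 (hr0.trans_le hrδ) hrδ)
  have hloglogL : Real.log (1 + Real.log L) ≤ Real.log (1 + L) := by
    refine Real.log_le_log (by linarith) ?_
    have := Real.log_le_sub_one_of_pos (by linarith : 0 < L)
    linarith
  -- A crude multiple of `L` suffices, since only `log n` enters the deviation; the resulting `log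
  -- 4` is absorbed by the gap between `C'` and `C`.
  have hσL : Real.log (σ r) ≤ 4 * L := by
    have h1 := Real.log_le_log (by linarith) (sigma_starCoeff_le hc hr0 hδ₀ hδ₀1)
    rw [Real.log_mul (by positivity) (by positivity), Real.log_mul (by norm_num) (by positivity),
      Real.log_rpow hδ₀, hlogδ₀] at h1
    nlinarith
  -- One below the floor makes `σ (ρ n) = exp n` strictly less than `σ r`, which forces `ρ n ≤ r`.
  -- The loss `log (σ r) < n + 2` is the `2` in `K`.
  set n := ⌊Real.log (σ r)⌋₊ - 1 with hn
  have hfl1 : (⌊Real.log (σ r)⌋₊ : ℝ) ≤ Real.log (σ r) := Nat.floor_le (by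
    linarith [Nat.cast_nonneg (α := ℝ) N])
  have hfl2 : Real.log (σ r) < ⌊Real.log (σ r)⌋₊ + 1 := Nat.lt_floor_add_one _
  have hflN : N + 2 ≤ ⌊Real.log (σ r)⌋₊ := Nat.le_floor (by push_cast; linarith)
  have hncast : (n : ℝ) = ⌊Real.log (σ r)⌋₊ - 1 := by
    rw [hn, Nat.cast_sub (by omega)]; simp
  have hnN : N ≤ n := by omega
  have hn1 : (1 : ℝ) ≤ n := by exact_mod_cast (show 1 ≤ n by omega)
  obtain ⟨hσn, hXn⟩ := hN n hnN
  have hρr : ρ n ≤ r := by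
    by_contra hlt
    push Not at hlt
    have h1 := sigma_mono hσs hr0.le hlt.le
    rw [← hσdef, hσn] at h1
    have h2 := (Real.log_le_iff_le_exp (by linarith)).2 h1
    linarith
  have hJmono := circleAverage_log_norm_monotoneOn hgd (hρ0 n) hr0 hρr
  have hJn := log_sub_le_circleAverage hgd hz₁ (hρ0 n) (sigma_pos hσs (hρ0 n) hbj)
  rw [← hσdef, hσn, Real.log_exp] at hJn
  rw [hσn] at hXn
  have hXn' := (abs_le.1 hXn).2
  have hlogn : Real.log n ≤ Real.log 4 + Real.log L := by
    rw [← Real.log_mul (by norm_num) (by linarith)]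
    exact Real.log_le_log (by linarith) (by linarith)
  have hXle : (C' / A * Real.log n) ^ (1 / B) ≤ (C / A * Real.log L) ^ (1 / B) := by
    refine Real.rpow_le_rpow ?_ ?_ (by positivity)
    · have := Real.log_nonneg hn1
      positivity
    · rw [div_mul_eq_mul_div, div_mul_eq_mul_div]
      refine div_le_div_of_nonneg_right ?_ hA.le
      nlinarith
  have hMle : L ≤ Real.log (‖c 0‖ + K₀) + Real.log (σ r) := by
    have h0 := norm_nonneg (c 0)
    rw [← Real.log_mul (by positivity) (by positivity)]
    refine Real.log_le_log (by linarith) ((hMσ r hr0).trans ?_)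
    nlinarith
  linarith

end Perturbed

end RandomEntire

/-! ### Combination of the two bounds. -/

theorem corollary4 {Ω : Type*} [MeasurableSpace Ω] (μ : Measure Ω) [IsProbabilityMeasure μ]
    (f : ℂ → ℂ) (hf : RandomEntire.IsTranscendentalEntire f)
    (c : ℕ → ℂ) (hc : ∀ z : ℂ, HasSum (fun j => c j * z ^ j) (f z))
    (χ : ℕ → Ω → ℂ) (hmeas : ∀ j, Measurable (χ j))
    (hindep : iIndepFun χ μ)
    (hident : ∀ i j, IdentDistrib (χ i) (χ j) μ μ)
    (hL2 : ∀ j, MemLp (χ j) 2 μ)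
    (hmean : ∀ j, ∫ ω, χ j ω ∂μ = 0)
    (hvar : ∀ j, ∫ ω, ‖χ j ω - ∫ ω', χ j ω' ∂μ‖ ^ 2 ∂μ = 1)
    (hY : ∃ A₀ B₀ : ℝ, RandomEntire.ConditionY μ χ c A₀ B₀)
    (A B : ℝ) (hYstar : RandomEntire.ConditionY μ χ (RandomEntire.starCoeff c) A B)
    (C : ℝ) (hC : 1 < C) :
    ∃ E : Set ℝ, RandomEntire.HasFiniteLogMeasure E ∧
      ∀ a : ℂ, ∀ᵐ ω ∂μ, ∃ η : ℝ → ℝ, Tendsto η atTop (𝓝 0) ∧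
        ∃ r₁ : ℝ, ∀ r : ℝ, r₁ < r → r ∉ E →
          |Real.log (RandomEntire.maxModulus f r) -
              RandomEntire.countingN r a (RandomEntire.randomSeries χ c ω)| ≤
            (C / A) ^ (1 / B) *
                Real.log (Real.log (RandomEntire.maxModulus f r)) ^ (1 / B) +
              (2 + η r) * Real.log (Real.log (RandomEntire.maxModulus f r)) := by
  have hA := hYstar.1
  have hB := hYstar.2.1
  have hone : ∀ j, ∫ ω, ‖χ j ω‖ ^ 2 ∂μ = 1 := by
    intro j
    have := hvar j
    simpa [hmean j] using this
  have hinf := hf.infinite_coeff hc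
  have hSinf : {j | j ≠ 0 ∧ c j ≠ 0}.Infinite := by
    refine (hinf.sdiff (Set.finite_singleton 0)).mono ?_
    rintro j ⟨h1, h2⟩
    exact ⟨h2, h1⟩
  obtain ⟨j₀, hj₀, hcj₀⟩ := hSinf.nonempty
  have hfd := hf.1
  have htop := RandomEntire.tendsto_maxModulus hc hj₀ hcj₀
  have hlogtop := Real.tendsto_log_atTop.comp htop
  have hloglogtop := Real.tendsto_log_atTop.comp hlogtop
  have hmono := RandomEntire.maxModulus_monotoneOn hfd
  have hlogmono : MonotoneOn (Real.log ∘ RandomEntire.maxModulus f) (Set.Ioi 0) :=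
    fun r hr s hs hrs => Real.log_le_log (RandomEntire.maxModulus_pos hc hcj₀ hr) (hmono hr hs hrs)
  obtain ⟨E₁, hE₁, hgrow₁⟩ := RandomEntire.exists_hasFiniteLogMeasure_growth hmono htop
  obtain ⟨E₂, hE₂, hgrow₂⟩ := RandomEntire.exists_hasFiniteLogMeasure_growth hlogmono hlogtop
  refine ⟨E₁ ∪ E₂, hE₁.union hE₂, fun a => ?_⟩
  have hsum := RandomEntire.ae_summable_norm_sq_div hmeas hL2 hone
  have hσs := RandomEntire.summable_sigma_terms (RandomEntire.summable_sq_mul_starCoeff hc)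
  have hb₀ : RandomEntire.starCoeff c j₀ ≠ 0 := mul_ne_zero (Nat.cast_ne_zero.2 hj₀) hcj₀
  obtain ⟨ρ, hρtop, hρ0, hρ⟩ := RandomEntire.exists_seq_sigma_eq_exp hσs hj₀ hb₀
  -- `C' > 1` is what Borel–Cantelli needs; `C' < C` leaves room for replacing `log n` by `log log
  -- M`.
  obtain ⟨C', hC'1, hC'C⟩ := exists_between hC
  have hdev := hYstar.ae_eventually_le
    (RandomEntire.aemeasurable_logDeviation hmeas hsum (RandomEntire.summable_sq_mul_starCoeff hc))
    hC'1 hρtop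
  filter_upwards [hsum, hdev,
    RandomEntire.ae_exists_ne_zero hmeas hindep hident hone hSinf] with ω hx hX hne
  -- A surviving coefficient of positive index keeps `f*_ω` from vanishing identically.
  obtain ⟨j, ⟨hj, hcj⟩, hxj⟩ := hne
  refine ⟨fun _ => 0, tendsto_const_nhds, ?_⟩
  have hupper := RandomEntire.eventually_countingN_le hc htop hx a
  have hmid := RandomEntire.eventually_circleAverage_star_le hc htop hx hj hcj hxj a
  obtain ⟨K, hlower⟩ := RandomEntire.eventually_log_maxModulus_le hc hx hj hcj hxj hA hB
    (zero_lt_one.trans hC'1) hC'C hρ0 hρ hX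
  have hgd := RandomEntire.differentiable_perturbed hc hx
  set κ := Real.log ‖meromorphicTrailingCoeffAt
    (fun z => ∑' j, χ j ω * c j * z ^ j - a) 0‖ with hκ
  have hev : ∀ᶠ r in atTop, r ∉ E₁ ∪ E₂ →
      |Real.log (RandomEntire.maxModulus f r) -
          RandomEntire.countingN r a (RandomEntire.randomSeries χ c ω)| ≤
        (C / A) ^ (1 / B) * Real.log (Real.log (RandomEntire.maxModulus f r)) ^ (1 / B) +
          (2 + 0) * Real.log (Real.log (RandomEntire.maxModulus f r)) := by
    -- The lower bound loses `(3/2) log log M + K + κ`; the last threshold makes `K + κ` at most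
    -- half of `log log M`, so the coefficient is `2` with zero error term.
    filter_upwards [hupper, hmid, hlower, hgrow₁, hgrow₂, eventually_gt_atTop 0,
      hloglogtop.eventually_ge_atTop 0, hloglogtop.eventually_ge_atTop (2 * (K + κ))]
      with r hup hmi hlo hg₁ hg₂ hr hLL hLL2 hrE
    rw [Set.mem_union, not_or] at hrE
    simp only [Function.comp_apply] at hLL hLL2 hg₂
    have h1 := hup (hg₁ hrE.1)
    have h2 := hmi (hg₂ hrE.2)
    have h3 := hlo (hg₂ hrE.2)
    have h4 := RandomEntire.countingN_eq_circleAverage_sub hgd a hr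
    rw [Real.mul_rpow (div_pos (by linarith) hA).le hLL] at h3
    have h5 : 0 ≤ (C / A) ^ (1 / B) *
        Real.log (Real.log (RandomEntire.maxModulus f r)) ^ (1 / B) :=
      mul_nonneg (Real.rpow_nonneg (div_pos (by linarith) hA).le _) (Real.rpow_nonneg hLL _)
    have e : RandomEntire.randomSeries χ c ω = fun z => ∑' j, χ j ω * c j * z ^ j := rfl
    rw [e, abs_le]
    constructor <;> linarith
  obtain ⟨r₁, hr₁⟩ := eventually_atTop.1 hev
  exact ⟨r₁, fun r hr hrE => hr₁ r hr.le hrE⟩
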